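/- Let $k$ be an odd integer, and let $\varphi$ be Euler's totient function. Then there is a constant $C>0$, depending only on $k$, such that for every real $x\ge e^{e}$ the number of positive integers $n\le x$ with $n+k\ge 1$ and $\varphi(n)=\varphi(n+k)$ is at most $$C\,x\exp\!\left(-2^{-1/2}(\log x\,\log\log\log x)^{1/2}\right).$$ -/

import Mathlib

/-- The number of positive integers `n ≤ x` for which `n + k` is positive and
`φ(n) = φ(n + k)`, where `φ` is Euler's totient function and `k` is an integer. -/
noncomputable def totientShiftCount (k : ℤ) (x : ℝ) : ℕ :=
  ((Finset.Icc 1 ⌊x⌋₊).filter fun n : ℕ =>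
    0 < (n : ℤ) + k ∧ Nat.totient n = Nat.totient ((n : ℤ) + k).toNat).card

/-! Write N = n + k and u = log log x, let A be the saving claimed in the exponent, and let B be
exp(A) times the cube of a quantity of order log x. First discard O(x (log x)^3 / B) values of n:
those for which n or N is divisible by r² with r > B, and those with primes p ∣ n, q ∣ N such that d
= gcd(p - 1, q - 1) > B in an atypical configuration. If pq ≤ x, or p and q differ by a factor of at
least B, or d > B² with pq ≤ xB, one writes primes as da + 1, db + 1 and counts residue classes
(`card_le_of_common_divisor`, `card_le_of_common_divisor_of_mul_le`). If pq > xB, the cofactors of p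
and q have product at most 2x/B and determine n: two solutions with the same cofactors m, m' would
force φ(m)/m = φ(m')/m', so m and m' have the same primes, hence the same parity, against k being
odd (`eq_of_cofactors_eq`).

For a surviving n, the B-rough part of p - 1 with p ∣ n divides φ(n) = φ(N), so it must be shared
with the numbers q - 1, q ∣ N. Such sharing now occurs only between primes exceeding √(x/B), of
which n and N have at most two each, and is at most B² per pair. Hence the product over p ∣ n of
these rough parts is at most B^8 (`primeMulHom_roughPart_le`).

Rankin's method (`card_le_rankin`) shows that such n are rare. It requires a bound for the sum over
primes of p^(-(1-η)) R(p - 1)^(-α), with R the rough part. For large p one forgets that p is prime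
and sums over all integers p - 1, which gives another Euler product (`sum_prime_rpow_roughPart_le`).
With η = (3/5) log u / log B and α = 4η, the factor x^(-η) saves at least exp(-12A/11), and all
other factors together cost less than exp(A/11). -/

/-! ### Completely multiplicative functions given on primes. -/

/-- The completely multiplicative function on `ℕ` with prescribed values at the primes. -/
noncomputable def primeMulHom {M : Type*} [CommMonoidWithZero M] (h : ℕ → M) : ℕ →* M where
  toFun n := if n = 0 then 0 else (n.primeFactorsList.map h).prod
  map_one' := by simp
  map_mul' a b := by
    by_cases ha : a = 0
    · simp [ha]
    by_cases hb : b = 0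
    · simp [hb]
    simp only [ha, hb, mul_eq_zero, or_self, if_false]
    rw [((Nat.perm_primeFactorsList_mul ha hb).map h).prod_eq, List.map_append, List.prod_append]

theorem primeMulHom_apply {M : Type*} [CommMonoidWithZero M] (h : ℕ → M) {n : ℕ} (hn : n ≠ 0) :
    primeMulHom h n = (n.primeFactorsList.map h).prod := by
  change (if n = 0 then 0 else _) = _
  rw [if_neg hn]

theorem primeMulHom_zero {M : Type*} [CommMonoidWithZero M] (h : ℕ → M) :
    primeMulHom h 0 = 0 := by
  change (if (0 : ℕ) = 0 then (0 : M) else ((Nat.primeFactorsList 0).map h).prod) = 0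
  rw [if_pos rfl]

theorem primeMulHom_prime {M : Type*} [CommMonoidWithZero M] (h : ℕ → M) {p : ℕ} (hp : p.Prime) :
    primeMulHom h p = h p := by
  rw [primeMulHom_apply h hp.ne_zero, Nat.primeFactorsList_prime hp]; simp

theorem primeMulHom_mul_apply {M : Type*} [CommMonoidWithZero M] (h h' : ℕ → M) {n : ℕ}
    (hn : n ≠ 0) :
    primeMulHom (fun p => h p * h' p) n = primeMulHom h n * primeMulHom h' n := by
  simp only [primeMulHom_apply _ hn, List.prod_map_mul]

theorem primeMulHom_natCast_self {n : ℕ} (hn : n ≠ 0) :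
    primeMulHom (fun p => p) n = n := by
  rw [primeMulHom_apply _ hn, List.map_id', Nat.prod_primeFactorsList hn]

theorem primeMulHom_natCast_rpow (h : ℕ → ℕ) (s : ℝ) {n : ℕ} (hn : n ≠ 0) :
    primeMulHom (fun p => (h p : ℝ) ^ s) n = (primeMulHom h n : ℝ) ^ s := by
  rw [primeMulHom_apply _ hn, primeMulHom_apply _ hn]
  induction n.primeFactorsList with
  | nil => simp
  | cons a l ih =>
    simp only [List.map_cons, List.prod_cons, Nat.cast_mul]
    rw [Real.mul_rpow (by positivity) (by positivity), ih]

theorem primeMulHom_rpow (s : ℝ) {n : ℕ} (hn : n ≠ 0) :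
    primeMulHom (fun p => (p : ℝ) ^ s) n = (n : ℝ) ^ s := by
  rw [primeMulHom_natCast_rpow (fun p => p) s hn, primeMulHom_natCast_self hn]

theorem primeMulHom_nonneg {h : ℕ → ℝ} (hh : ∀ p, p.Prime → 0 ≤ h p) (n : ℕ) :
    0 ≤ primeMulHom h n := by
  rcases eq_or_ne n 0 with rfl | hn
  · simp [primeMulHom_zero]
  rw [primeMulHom_apply h hn]
  apply List.prod_nonneg
  intro a ha
  obtain ⟨p, hp, rfl⟩ := List.mem_map.1 ha
  exact hh p (Nat.prime_of_mem_primeFactorsList hp)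

theorem one_le_primeMulHom {h : ℕ → ℕ} (hh : ∀ p, p.Prime → 1 ≤ h p) {n : ℕ} (hn : n ≠ 0) :
    1 ≤ primeMulHom h n := by
  rw [primeMulHom_apply h hn, Nat.one_le_iff_ne_zero]
  apply List.prod_ne_zero
  intro h0
  obtain ⟨p, hp, h1⟩ := List.mem_map.1 h0
  have := hh p (Nat.prime_of_mem_primeFactorsList hp)
  omega

/-! ### Euler products and Mertens-type bounds. -/

/-- A partial sum of a completely multiplicative function is at most its Euler product. -/
theorem sum_primeMulHom_le_prod {h : ℕ → ℝ} (h0 : ∀ p, p.Prime → 0 ≤ h p)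
    (h1 : ∀ p, p.Prime → h p < 1) (N : ℕ) :
    ∑ n ∈ Finset.Icc 1 N, primeMulHom h n ≤ ∏ p ∈ (N + 1).primesBelow, (1 - h p)⁻¹ := by
  have key := EulerProduct.summable_and_hasSum_smoothNumbers_prod_primesBelow_geometric
    (f := primeMulHom h) (fun {p} hp => by
      rw [primeMulHom_prime h hp, Real.norm_of_nonneg (h0 p hp)]; exact h1 p hp) (N + 1)
  have e : ∏ p ∈ (N + 1).primesBelow, (1 - primeMulHom h p)⁻¹ =
      ∏ p ∈ (N + 1).primesBelow, (1 - h p)⁻¹ :=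
    Finset.prod_congr rfl fun p hp => by
      rw [primeMulHom_prime h (Nat.prime_of_mem_primesBelow hp)]
  rw [e] at key
  -- Every 1 ≤ n ≤ N is (N + 1)-smooth, so the partial sum is part of the nonnegative series that
  -- the product expands into.
  have hmem : ∀ n ∈ Finset.Icc 1 N, n ∈ (N + 1).smoothNumbers := by
    intro n hn
    rw [Finset.mem_Icc] at hn
    rw [Nat.mem_smoothNumbers]
    exact ⟨by omega, fun p hp => by
      have := Nat.le_of_mem_primeFactorsList hp
      omega⟩
  have := sum_le_hasSum ((Finset.Icc 1 N).attach.map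
    ⟨fun n => (⟨n.1, hmem n.1 n.2⟩ : (N + 1).smoothNumbers), fun a b hab => by
      apply Subtype.ext; exact Subtype.mk.inj hab⟩)
    (fun i _ => primeMulHom_nonneg h0 i.1) key.2
  rw [Finset.sum_map] at this
  exact (Finset.sum_attach (Finset.Icc 1 N) (fun n => primeMulHom h n)).symm.trans_le this

/-- Integral comparison in a form that telescopes. With m = n + 1 it reduces to (n/m)^(1-s) ≥ 1 +
(s-1)/m, which follows from log t ≤ t - 1 and 1 + t ≤ exp t. -/
theorem natCast_succ_rpow_neg_le {s : ℝ} (hs : 1 < s) (n : ℕ) (hn : 1 ≤ n) :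
    ((n + 1 : ℕ) : ℝ) ^ (-s) ≤
      ((n : ℝ) ^ (1 - s) - ((n + 1 : ℕ) : ℝ) ^ (1 - s)) / (s - 1) := by
  have hn0 : (0 : ℝ) < n := by exact_mod_cast hn
  have hm0 : (0 : ℝ) < ((n + 1 : ℕ) : ℝ) := by positivity
  rw [le_div_iff₀ (by linarith)]
  set m : ℝ := ((n + 1 : ℕ) : ℝ) with hm
  have hmn : m = n + 1 := by rw [hm]; push_cast; ring
  have h1 : 1 + (s - 1) / m ≤ (n / m) ^ (1 - s) := by
    rw [Real.rpow_def_of_pos (by positivity)]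
    have hlog : Real.log (n / m) ≤ n / m - 1 := Real.log_le_sub_one_of_pos (by positivity)
    have e : (n : ℝ) / m - 1 = -(1 / m) := by
      field_simp; rw [hmn]; ring
    rw [e] at hlog
    have := Real.add_one_le_exp (Real.log (n / m) * (1 - s))
    have h2 : (s - 1) / m ≤ Real.log (n / m) * (1 - s) := by
      have : (s - 1) * (1 / m) ≤ (s - 1) * (-Real.log (n / m)) :=
        mul_le_mul_of_nonneg_left (by linarith) (by linarith)
      calc (s - 1) / m = (s - 1) * (1 / m) := by ring
        _ ≤ _ := this
        _ = _ := by ring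
    linarith
  rw [Real.div_rpow hn0.le hm0.le, le_div_iff₀ (by positivity)] at h1
  have h3 : m ^ (-s) = m ^ (1 - s) / m := by
    rw [← Real.rpow_sub_one hm0.ne']; congr 1; ring
  rw [h3]
  calc m ^ (1 - s) / m * (s - 1) = (1 + (s - 1) / m) * m ^ (1 - s) - m ^ (1 - s) := by ring
    _ ≤ _ := by linarith

theorem sum_range_rpow_neg_le {s : ℝ} (hs : 1 < s) (N : ℕ) :
    ∑ n ∈ Finset.range N, ((n + 1 : ℕ) : ℝ) ^ (-s) ≤ 1 + 1 / (s - 1) := by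
  have key : ∀ N : ℕ, ∑ n ∈ Finset.range (N + 1), ((n + 1 : ℕ) : ℝ) ^ (-s) ≤
      1 + (1 - ((N + 1 : ℕ) : ℝ) ^ (1 - s)) / (s - 1) := by
    intro N
    induction N with
    | zero => simp
    | succ N ih =>
      rw [Finset.sum_range_succ]
      have := natCast_succ_rpow_neg_le hs (N + 1) (by omega)
      have e : (1 - ((N + 1 : ℕ) : ℝ) ^ (1 - s)) / (s - 1) +
        (((N + 1 : ℕ) : ℝ) ^ (1 - s) - ((N + 1 + 1 : ℕ) : ℝ) ^ (1 - s)) / (s - 1) =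
        (1 - ((N + 1 + 1 : ℕ) : ℝ) ^ (1 - s)) / (s - 1) := by ring
      linarith
  rcases N with _ | N
  · have : 0 < 1 / (s - 1) := by apply div_pos <;> linarith
    simp only [Finset.range_zero, Finset.sum_empty]; linarith
  · refine (key N).trans ?_
    have : (0 : ℝ) ≤ ((N + 1 : ℕ) : ℝ) ^ (1 - s) := by positivity
    have h0 : 0 < s - 1 := by linarith
    gcongr
    linarith

/-- The product expands into the part of ζ(s) supported on smooth numbers, and ζ(s) is bounded by
telescoping. -/
theorem prod_primesBelow_one_sub_rpow_inv_le {s : ℝ} (hs : 1 < s) (N : ℕ) :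
    ∏ p ∈ N.primesBelow, (1 - (p : ℝ) ^ (-s))⁻¹ ≤ 1 + 1 / (s - 1) := by
  set f := primeMulHom (fun p => (p : ℝ) ^ (-s)) with hf
  have hfn : ∀ n, n ≠ 0 → f n = (n : ℝ) ^ (-s) := fun n hn => primeMulHom_rpow _ hn
  have hf0 : f 0 = 0 := primeMulHom_zero _
  have hnn : ∀ n, 0 ≤ f n := fun n => primeMulHom_nonneg (fun p _ => by positivity) n
  have hbound : ∀ M, ∑ n ∈ Finset.range M, f n ≤ 1 + 1 / (s - 1) := by
    intro M
    rcases M with _ | M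
    · simpa using (sum_range_rpow_neg_le hs 0)
    · rw [Finset.sum_range_succ', hf0, add_zero]
      rw [Finset.sum_congr rfl fun n _ => hfn (n + 1) (by omega)]
      exact sum_range_rpow_neg_le hs M
  have hsum : Summable f := summable_of_sum_range_le hnn hbound
  have key := EulerProduct.summable_and_hasSum_smoothNumbers_prod_primesBelow_geometric
    (f := f) (fun {p} hp => hsum.norm_lt_one hp.one_lt) N
  have e : ∏ p ∈ N.primesBelow, (1 - (p : ℝ) ^ (-s))⁻¹ = ∏ p ∈ N.primesBelow, (1 - f p)⁻¹ :=
    Finset.prod_congr rfl fun p hp => by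
      rw [hfn p (Nat.prime_of_mem_primesBelow hp).ne_zero]
  rw [e, ← key.2.tsum_eq]
  exact (hsum.tsum_subtype_le _ _ hnn).trans (Real.tsum_le_of_sum_range_le hnn hbound)

theorem rpow_neg_lt_one {p : ℕ} (hp : p.Prime) {s : ℝ} (hs : 0 < s) : (p : ℝ) ^ (-s) < 1 :=
  Real.rpow_lt_one_of_one_lt_of_neg (by exact_mod_cast hp.one_lt) (by linarith)

theorem sum_primesBelow_rpow_neg_le {s : ℝ} (hs : 1 < s) (N : ℕ) :
    ∑ p ∈ N.primesBelow, (p : ℝ) ^ (-s) ≤ Real.log (1 + 1 / (s - 1)) := by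
  rw [Real.le_log_iff_exp_le (by have : 0 < 1 / (s - 1) := by { apply div_pos <;> linarith }
                                 linarith), Real.exp_sum]
  refine le_trans (Finset.prod_le_prod (fun _ _ => (Real.exp_pos _).le) fun p hp => ?_)
    (prod_primesBelow_one_sub_rpow_inv_le hs N)
  have hlt := rpow_neg_lt_one (Nat.prime_of_mem_primesBelow hp) (by linarith : 0 < s)
  rw [le_inv_comm₀ (Real.exp_pos _) (by linarith), ← Real.exp_neg]
  have := Real.add_one_le_exp (-(p : ℝ) ^ (-s))
  linarith

/-- A weak form of Mertens' second theorem. -/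
theorem sum_primes_inv_le {z : ℝ} (hz : 1 < z) :
    ∑ p ∈ (⌊z⌋₊ + 1).primesBelow, (p : ℝ)⁻¹ ≤
      Real.exp 1 * Real.log (1 + Real.log z) := by
  have hlz : 0 < Real.log z := Real.log_pos hz
  -- At this exponent p⁻¹ is at most e times p^(-s) for every p ≤ z.
  have h := sum_primesBelow_rpow_neg_le (s := 1 + 1 / Real.log z)
    (by have : 0 < 1 / Real.log z := by positivity
        linarith) (⌊z⌋₊ + 1)
  rw [add_sub_cancel_left, one_div_one_div] at h
  refine le_trans ?_ (mul_le_mul_of_nonneg_left h (Real.exp_pos 1).le)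
  rw [Finset.mul_sum]
  apply Finset.sum_le_sum
  intro p hp
  have hp' := Nat.prime_of_mem_primesBelow hp
  have hpz : (p : ℝ) ≤ z := by
    have := Nat.lt_of_mem_primesBelow hp
    exact (Nat.le_floor_iff (by linarith)).1 (by omega)
  have hp0 : (0 : ℝ) < p := by exact_mod_cast hp'.pos
  have : (p : ℝ)⁻¹ = Real.exp (Real.log p / Real.log z) * (p : ℝ) ^ (-(1 + 1 / Real.log z)) := by
    rw [Real.rpow_def_of_pos hp0, ← Real.exp_add]
    rw [show Real.log p / Real.log z + Real.log p * -(1 + 1 / Real.log z) = -Real.log p by ring,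
      Real.exp_neg, Real.exp_log hp0]
  rw [this]
  gcongr
  rw [div_le_one hlz]
  exact Real.log_le_log hp0 hpz

/-- A weak form of Mertens' first theorem. -/
theorem sum_primes_log_div_le (N : ℕ) :
    ∑ p ∈ (N + 1).primesBelow, Real.log p / p ≤ Real.log N + Real.log 4 := by
  rcases Nat.eq_zero_or_pos N with rfl | hN
  · have : (0 + 1).primesBelow = ∅ := by decide
    rw [this]; simp; positivity
  have hN' : (0 : ℝ) < N := by exact_mod_cast hN
  -- Legendre's argument keeping one power per prime: the product of p^⌊N/p⌋ divides N!. Rounding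
  -- N/p down loses at most the Chebyshev sum bounded in `h3`.
  have h1 : ∑ p ∈ (N + 1).primesBelow, ((N / p : ℕ) : ℝ) * Real.log p ≤ Real.log (N.factorial) := by
    have hd : ∏ p ∈ (N + 1).primesBelow, p ^ (N / p) ∣ N.factorial := by
      apply Finset.prod_dvd_of_isRelPrime
      · intro p hp q hq hpq
        apply Nat.coprime_iff_isRelPrime.1
        apply Nat.Coprime.pow
        exact (Nat.coprime_primes (Nat.prime_of_mem_primesBelow hp)
          (Nat.prime_of_mem_primesBelow hq)).2 hpq
      · intro p hp
        have hp' := Nat.prime_of_mem_primesBelow hp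
        rw [hp'.pow_dvd_factorial_iff (b := N + 1) (by
          exact Nat.lt_succ_of_le (Nat.log_le_self _ _))]
        have : N / p = N / p ^ 1 := by rw [pow_one]
        rw [this]
        apply Finset.single_le_sum (f := fun i => N / p ^ i) (fun _ _ => Nat.zero_le _)
        simp; omega
    have hle := Nat.le_of_dvd (Nat.factorial_pos N) hd
    have hne : ∀ p ∈ (N + 1).primesBelow, ((p ^ (N / p) : ℕ) : ℝ) ≠ 0 := fun p hp => by
      have := (Nat.prime_of_mem_primesBelow hp).pos
      positivity
    calc ∑ p ∈ (N + 1).primesBelow, ((N / p : ℕ) : ℝ) * Real.log p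
        = Real.log ((∏ p ∈ (N + 1).primesBelow, p ^ (N / p) : ℕ) : ℝ) := by
          rw [Nat.cast_prod, Real.log_prod hne]
          apply Finset.sum_congr rfl
          intro p _
          rw [Nat.cast_pow, Real.log_pow]
      _ ≤ _ := by
          apply Real.log_le_log
          · rw [Nat.cast_prod]
            apply Finset.prod_pos
            intro p hp
            have := (Nat.prime_of_mem_primesBelow hp).pos
            positivity
          · exact_mod_cast hle
  have h2 : Real.log (N.factorial) ≤ N * Real.log N := by
    rw [← Real.log_pow]
    apply Real.log_le_log (by exact_mod_cast Nat.factorial_pos N)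
    exact_mod_cast Nat.factorial_le_pow N
  have h3 : ∑ p ∈ (N + 1).primesBelow, Real.log p ≤ Real.log 4 * N := by
    have := Chebyshev.theta_le_log4_mul_x (x := N) (by positivity)
    rwa [Chebyshev.theta_eq_sum_primesLE_log] at this
  have h4 : ∑ p ∈ (N + 1).primesBelow, (N : ℝ) * (Real.log p / p) ≤
      ∑ p ∈ (N + 1).primesBelow, (((N / p : ℕ) : ℝ) * Real.log p + Real.log p) := by
    apply Finset.sum_le_sum
    intro p hp
    have hp' := Nat.prime_of_mem_primesBelow hp
    have hp0 : (0 : ℝ) < p := by exact_mod_cast hp'.pos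
    have hlog : 0 ≤ Real.log p := Real.log_natCast_nonneg p
    have : (N : ℝ) / p ≤ ((N / p : ℕ) : ℝ) + 1 := by
      rw [div_le_iff₀ hp0]
      have := (Nat.lt_div_mul_add hp'.pos (a := N)).le
      have h : N ≤ (N / p + 1) * p := by linarith
      exact_mod_cast h
    calc (N : ℝ) * (Real.log p / p) = N / p * Real.log p := by ring
      _ ≤ (((N / p : ℕ) : ℝ) + 1) * Real.log p := by gcongr
      _ = _ := by ring
  rw [← Finset.mul_sum, Finset.sum_add_distrib] at h4
  have h5 : (N : ℝ) * ∑ p ∈ (N + 1).primesBelow, Real.log p / p ≤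
      N * (Real.log N + Real.log 4) := by linarith
  exact le_of_mul_le_mul_left h5 hN'

/-! ### Rigidity of φ(m)/m and of the cofactors. -/

/-- The ratio `φ(m) / m` determines the set of prime factors of `m`. -/
theorem primeFactors_eq_of_mul_totient_eq {a b : ℕ} (ha : a ≠ 0) (hb : b ≠ 0)
    (h : a * b.totient = b * a.totient) : a.primeFactors = b.primeFactors := by
  by_contra hne
  set A := a.primeFactors with hA
  set B := b.primeFactors with hB
  -- the products over the primes dividing only one of the two numbers
  have h1 : (∏ p ∈ A, p) * ∏ p ∈ B, (p - 1) = (∏ p ∈ B, p) * ∏ p ∈ A, (p - 1) := by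
    have ea := Nat.totient_mul_prod_primeFactors a
    have eb := Nat.totient_mul_prod_primeFactors b
    rw [← hA] at ea
    rw [← hB] at eb
    have hab : 0 < a * b := Nat.pos_of_ne_zero (mul_ne_zero ha hb)
    apply Nat.eq_of_mul_eq_mul_left hab
    calc a * b * ((∏ p ∈ A, p) * ∏ p ∈ B, (p - 1))
        = a * (∏ p ∈ A, p) * (b * ∏ p ∈ B, (p - 1)) := by ring
      _ = (a * b.totient) * ((∏ p ∈ A, p) * ∏ p ∈ B, p) := by rw [← eb]; ring
      _ = (b * a.totient) * ((∏ p ∈ A, p) * ∏ p ∈ B, p) := by rw [h]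
      _ = (a.totient * ∏ p ∈ A, p) * (b * ∏ p ∈ B, p) := by ring
      _ = _ := by rw [ea]; ring
  have hpA : ∀ p ∈ A, p.Prime := fun p hp => Nat.prime_of_mem_primeFactors hp
  have hpB : ∀ p ∈ B, p.Prime := fun p hp => Nat.prime_of_mem_primeFactors hp
  have h2 : (∏ p ∈ A \ B, p) * ∏ p ∈ B \ A, (p - 1) =
      (∏ p ∈ B \ A, p) * ∏ p ∈ A \ B, (p - 1) := by
    rw [← Finset.prod_inter_mul_prod_sdiff A B, ← Finset.prod_inter_mul_prod_sdiff B A,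
      ← Finset.prod_inter_mul_prod_sdiff B A, ← Finset.prod_inter_mul_prod_sdiff A B,
      Finset.inter_comm B A] at h1
    have hpos : 0 < (∏ p ∈ A ∩ B, p) * ∏ p ∈ A ∩ B, (p - 1) := by
      apply Nat.mul_pos
      · exact Finset.prod_pos fun p hp => (hpA p (Finset.mem_inter.1 hp).1).pos
      · exact Finset.prod_pos fun p hp => by
          have := (hpA p (Finset.mem_inter.1 hp).1).two_le; omega
    apply Nat.eq_of_mul_eq_mul_left hpos
    calc _ = (∏ p ∈ A ∩ B, p) * (∏ p ∈ A \ B, p) *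
          ((∏ p ∈ A ∩ B, (p - 1)) * ∏ p ∈ B \ A, (p - 1)) := by ring
      _ = _ := h1
      _ = _ := by ring
  have hU : ((A \ B) ∪ (B \ A)).Nonempty := by
    rw [Finset.nonempty_iff_ne_empty]
    intro h0
    rw [Finset.union_eq_empty, Finset.sdiff_eq_empty_iff_subset,
      Finset.sdiff_eq_empty_iff_subset] at h0
    exact hne (Finset.Subset.antisymm h0.1 h0.2)
  -- The largest prime of the symmetric difference divides one side of `h2` but not the other: it is
  -- not among the primes of the opposite set, and it is too large to divide any q - 1 with q ≤ p.
  obtain ⟨p, hp, hmax⟩ := Finset.exists_max_image _ id hU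
  simp only [id] at hmax
  have key : ∀ U V : Finset ℕ, (∀ q ∈ U, q.Prime) → (∀ q ∈ V, q.Prime) → Disjoint U V →
      (∀ q ∈ U, q ≤ p) → p ∈ U →
      (∏ p ∈ U, p) * ∏ p ∈ V, (p - 1) = (∏ p ∈ V, p) * ∏ p ∈ U, (p - 1) → False := by
    intro U V hU hV hd hle hpU heq
    have hpp := hU p hpU
    have hdvd : p ∣ (∏ p ∈ V, p) * ∏ p ∈ U, (p - 1) := by
      rw [← heq]; exact Dvd.dvd.mul_right (Finset.dvd_prod_of_mem _ hpU) _
    rcases (hpp.dvd_mul).1 hdvd with h | h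
    · obtain ⟨q, hq, hpq⟩ := (hpp.prime.dvd_finsetProd_iff _).1 h
      rw [(Nat.prime_dvd_prime_iff_eq hpp (hV q hq)).1 hpq] at hpU
      exact Finset.disjoint_left.1 hd hpU hq
    · obtain ⟨q, hq, hpq⟩ := (hpp.prime.dvd_finsetProd_iff _).1 h
      have h2 := (hU q hq).two_le
      have := Nat.le_of_dvd (by omega) hpq
      have := hle q hq
      omega
  have hd1 : Disjoint (A \ B) (B \ A) := disjoint_sdiff_sdiff
  have hA' : ∀ q ∈ A \ B, q.Prime := fun q hq => hpA q (Finset.mem_sdiff.1 hq).1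
  have hB' : ∀ q ∈ B \ A, q.Prime := fun q hq => hpB q (Finset.mem_sdiff.1 hq).1
  rcases Finset.mem_union.1 hp with h | h
  · exact key _ _ hA' hB' hd1 (fun q hq => hmax q (Finset.mem_union_left _ hq)) h h2
  · exact key _ _ hB' hA' hd1.symm (fun q hq => hmax q (Finset.mem_union_right _ hq)) h h2.symm

/-- The cofactors of a prime factor of `n` and of a prime factor of `n + k` determine `n`
when `φ(n) = φ(n + k)` and `k` is odd. -/
theorem eq_of_cofactors_eq {k : ℤ} (hk : Odd k) {m m' p q p₁ q₁ : ℕ} (hm : m ≠ 0) (hm' : m' ≠ 0)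
    (hp : p.Prime) (hq : q.Prime) (hp₁ : p₁.Prime) (hq₁ : q₁.Prime)
    (hpm : ¬ p ∣ m) (hqm : ¬ q ∣ m') (hpm₁ : ¬ p₁ ∣ m) (hqm₁ : ¬ q₁ ∣ m')
    (hp2 : p ≠ 2) (hq2 : q ≠ 2)
    (h : (p * m : ℤ) + k = q * m') (h₁ : (p₁ * m : ℤ) + k = q₁ * m')
    (hφ : (p * m).totient = (q * m').totient) (hφ₁ : (p₁ * m).totient = (q₁ * m').totient) :
    p = p₁ := by
  by_contra hne
  have tot : ∀ {r s : ℕ}, r.Prime → ¬ r ∣ s → ((r * s).totient : ℤ) = (r - 1) * s.totient := by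
    intro r s hr hrs
    rw [Nat.totient_mul ((Nat.Prime.coprime_iff_not_dvd hr).2 hrs), Nat.totient_prime hr]
    push_cast [hr.one_le]; ring
  have e : ((p : ℤ) - 1) * m.totient = (q - 1) * m'.totient := by
    rw [← tot hp hpm, ← tot hq hqm, hφ]
  have e₁ : ((p₁ : ℤ) - 1) * m.totient = (q₁ - 1) * m'.totient := by
    rw [← tot hp₁ hpm₁, ← tot hq₁ hqm₁, hφ₁]
  have hne' : ((p : ℤ) - p₁) ≠ 0 := sub_ne_zero.2 (by exact_mod_cast hne)
  have f1 : ((p : ℤ) - p₁) * m = (q - q₁) * m' := by linear_combination h - h₁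
  have f2 : ((p : ℤ) - p₁) * m.totient = (q - q₁) * m'.totient := by linear_combination e - e₁
  -- Eliminating the two differences gives φ(m)/m = φ(m')/m'. Of the resulting equality of prime
  -- sets only the prime 2 is needed: as p and q are odd, it gives pm and qm' the same parity.
  have f3 : (m : ℤ) * m'.totient = m' * m.totient := by
    apply mul_left_cancel₀ hne'
    linear_combination m'.totient * f1 - m' * f2
  have hrad := primeFactors_eq_of_mul_totient_eq hm hm' (by exact_mod_cast f3)
  have h2 : 2 ∣ m ↔ 2 ∣ m' := by
    have := Finset.ext_iff.1 hrad 2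
    simpa [Nat.prime_two, hm, hm'] using this
  have hpo := hp.odd_of_ne_two hp2
  have hqo := hq.odd_of_ne_two hq2
  rw [← even_iff_two_dvd, ← even_iff_two_dvd] at h2
  have hpz : Odd (p : ℤ) := by exact_mod_cast hpo
  have hqz : Odd (q : ℤ) := by exact_mod_cast hqo
  rcases Nat.even_or_odd m with hme | hmo
  · have hme' := h2.1 hme
    have a1 : Even ((p * m : ℤ)) := (by exact_mod_cast hme : Even (m : ℤ)).mul_left _
    have a2 : Even ((q * m' : ℤ)) := (by exact_mod_cast hme' : Even (m' : ℤ)).mul_left _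
    rw [← h] at a2
    exact (Int.not_even_iff_odd.2 (a1.add_odd hk)) a2
  · have hmo' : Odd m' := by
      rw [← Nat.not_even_iff_odd] at hmo ⊢
      rwa [← h2]
    have a1 : Odd ((p * m : ℤ)) := hpz.mul (by exact_mod_cast hmo)
    have a2 : Odd ((q * m' : ℤ)) := hqz.mul (by exact_mod_cast hmo')
    rw [← h] at a2
    exact (Int.not_even_iff_odd.2 a2) (a1.add_odd hk)

/-! ### Counting the exceptional n by residue classes. -/

/-- On a single residue class n ↦ n / h is injective; the value 0 accounts for the extra 1. -/
theorem card_le_of_modEq {S : Finset ℕ} {x : ℝ} {h : ℕ} (hh : 0 < h) (hx : 0 ≤ x)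
    (hS : ∀ n ∈ S, (n : ℝ) ≤ x) (hmod : ∀ a ∈ S, ∀ b ∈ S, a ≡ b [MOD h]) :
    (S.card : ℝ) ≤ x / h + 1 := by
  have hcard : S.card ≤ (Finset.range (⌊x / h⌋₊ + 1)).card := by
    apply Finset.card_le_card_of_injOn (fun n => n / h)
    · intro n hn
      simp only [Finset.coe_range, Set.mem_Iio]
      rw [Nat.lt_succ_iff, Nat.le_floor_iff (by positivity), le_div_iff₀ (by exact_mod_cast hh)]
      refine le_trans ?_ (hS n hn)
      exact_mod_cast Nat.div_mul_le_self n h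
    · intro a ha b hb hab
      have := hmod a ha b hb
      rw [← Nat.div_add_mod a h, ← Nat.div_add_mod b h, this]
      simp only at hab
      rw [hab]
  rw [Finset.card_range] at hcard
  have h1 : (S.card : ℝ) ≤ (⌊x / h⌋₊ : ℝ) + 1 := by exact_mod_cast hcard
  have h2 := Nat.floor_le (by positivity : 0 ≤ x / h)
  linarith

theorem card_le_sum_of_cover {ι : Type*} {S : Finset ℕ} (F : Finset ι) (P : ι → ℕ → Prop)
    (c : ι → ℝ) (hcov : ∀ n ∈ S, ∃ i ∈ F, P i n)
    (hc : ∀ i ∈ F, ∀ U : Finset ℕ, U ⊆ S → (∀ n ∈ U, P i n) → (U.card : ℝ) ≤ c i) :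
    (S.card : ℝ) ≤ ∑ i ∈ F, c i := by
  classical
  have hsub : S ⊆ F.biUnion fun i => S.filter (P i) := by
    intro n hn
    obtain ⟨i, hi, hPi⟩ := hcov n hn
    exact Finset.mem_biUnion.2 ⟨i, hi, Finset.mem_filter.2 ⟨hn, hPi⟩⟩
  calc (S.card : ℝ) ≤ ((F.biUnion fun i => S.filter (P i)).card : ℝ) := by
        exact_mod_cast Finset.card_le_card hsub
    _ ≤ ((∑ i ∈ F, (S.filter (P i)).card : ℕ) : ℝ) := by exact_mod_cast Finset.card_biUnion_le
    _ = ∑ i ∈ F, ((S.filter (P i)).card : ℝ) := by push_cast; rfl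
    _ ≤ _ := Finset.sum_le_sum fun i hi =>
        hc i hi _ (Finset.filter_subset _ _) fun n hn => (Finset.mem_filter.1 hn).2

theorem sum_inv_Icc_floor_le {T : ℝ} (hT : 1 ≤ T) :
    ∑ a ∈ Finset.Icc 1 ⌊T⌋₊, (a : ℝ)⁻¹ ≤ 1 + Real.log T := by
  have h := harmonic_le_one_add_log ⌊T⌋₊
  rw [harmonic_eq_sum_Icc] at h
  push_cast at h
  refine h.trans ?_
  have h1 : (1 : ℝ) ≤ ⌊T⌋₊ := by exact_mod_cast (Nat.one_le_floor_iff T).2 hT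
  have := Real.log_le_log (by linarith) (Nat.floor_le (by linarith : 0 ≤ T))
  linarith

theorem sum_inv_sq_le {d₀ : ℝ} (hd : 0 < d₀) (N : ℕ) :
    ∑ d ∈ (Finset.Icc 1 N).filter (fun d : ℕ => d₀ < d), ((d : ℝ) ^ 2)⁻¹ ≤ 2 / d₀ := by
  have hsub : (Finset.Icc 1 N).filter (fun d : ℕ => d₀ < d) ⊆ Finset.Ioo ⌊d₀⌋₊ (N + 1) := by
    intro d hd'
    simp only [Finset.mem_filter, Finset.mem_Icc] at hd'
    rw [Finset.mem_Ioo]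
    exact ⟨(Nat.floor_lt hd.le).2 hd'.2, by omega⟩
  refine (Finset.sum_le_sum_of_subset_of_nonneg hsub fun _ _ _ => by positivity).trans ?_
  refine (sum_Ioo_inv_sq_le (α := ℝ) ⌊d₀⌋₊ (N + 1)).trans ?_
  have := (Nat.lt_floor_add_one d₀).le
  gcongr

theorem card_le_of_sq_dvd {S : Finset ℕ} {x d₀ : ℝ} (hd : 0 < d₀) (hx : 0 ≤ x)
    (hS : ∀ n ∈ S, 1 ≤ n ∧ (n : ℝ) ≤ x ∧ ∃ r : ℕ, d₀ < r ∧ r ^ 2 ∣ n) :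
    (S.card : ℝ) ≤ 2 * x / d₀ := by
  have h := card_le_sum_of_cover (S := S) ((Finset.Icc 1 ⌊x⌋₊).filter (fun d : ℕ => d₀ < d))
    (fun r n => r ^ 2 ∣ n) (fun r => x * ((r : ℝ) ^ 2)⁻¹) ?_ ?_
  · rw [← Finset.mul_sum] at h
    refine h.trans ?_
    calc _ ≤ x * (2 / d₀) := mul_le_mul_of_nonneg_left (sum_inv_sq_le hd _) hx
      _ = _ := by ring
  · intro n hn
    obtain ⟨h1, hnx, r, hr, hrn⟩ := hS n hn
    refine ⟨r, ?_, hrn⟩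
    rw [Finset.mem_filter, Finset.mem_Icc]
    have hr0 : 0 < r := by exact_mod_cast hd.trans hr
    refine ⟨⟨hr0, ?_⟩, hr⟩
    apply Nat.le_floor
    refine le_trans ?_ hnx
    have := Nat.le_of_dvd h1 hrn
    have h2 : r ≤ r ^ 2 := Nat.le_self_pow (by norm_num) r
    exact_mod_cast h2.trans this
  · intro r hr U hU hUr
    rw [Finset.mem_filter, Finset.mem_Icc] at hr
    have hr0 : 0 < r ^ 2 := by have := hr.1.1; positivity
    have hsub : U ⊆ (Finset.Ioc 0 ⌊x⌋₊).filter (fun n => r ^ 2 ∣ n) := by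
      intro n hn
      rw [Finset.mem_filter, Finset.mem_Ioc]
      have := hS n (hU hn)
      exact ⟨⟨this.1, Nat.le_floor this.2.1⟩, hUr n hn⟩
    have hc := Finset.card_le_card hsub
    rw [Nat.Ioc_filter_dvd_card_eq_div] at hc
    calc (U.card : ℝ) ≤ ((⌊x⌋₊ / r ^ 2 : ℕ) : ℝ) := by exact_mod_cast hc
      _ ≤ (⌊x⌋₊ : ℝ) / ((r ^ 2 : ℕ) : ℝ) := Nat.cast_div_le
      _ ≤ x / ((r ^ 2 : ℕ) : ℝ) := by
          gcongr
          exact Nat.floor_le hx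
      _ = _ := by push_cast; rw [div_eq_mul_inv]

theorem exists_eq_mul_add_one {d p : ℕ} (hp : p.Prime) (h : d ∣ p - 1) :
    ∃ a, 1 ≤ a ∧ p = d * a + 1 := by
  obtain ⟨a, ha⟩ := h
  have := hp.two_le
  refine ⟨a, ?_, by omega⟩
  rcases Nat.eq_zero_or_pos a with rfl | h
  · omega
  · exact h

/-- Few `n` have prime factors `p ∣ n`, `q ∣ n + k` with `p q` small and `gcd (p - 1) (q - 1)`
large. -/
theorem card_le_of_common_divisor {S : Finset ℕ} {k : ℤ} {x T d₀ : ℝ} (hd : 0 < d₀)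
    (hx : 0 ≤ x) (hT : 1 ≤ T)
    (hS : ∀ n ∈ S, (n : ℝ) ≤ x ∧ ∃ p q d : ℕ, p.Prime ∧ q.Prime ∧ p ≠ q ∧ p ∣ n ∧
      (q : ℤ) ∣ n + k ∧ d₀ < d ∧ d ∣ p - 1 ∧ d ∣ q - 1 ∧ (p : ℝ) * q ≤ T) :
    (S.card : ℝ) ≤ 2 * (x + T) * (1 + Real.log T) ^ 2 / d₀ := by
  have hlT : 0 ≤ Real.log T := Real.log_nonneg hT
  have h := card_le_sum_of_cover (S := S)
    -- The index is (d, a, b) with p = da + 1 and q = db + 1. Summing the weight over free a and b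
    -- costs two logarithms, and the tail of the sum of 1/d² saves d₀.
    (((Finset.Icc 1 ⌊T⌋₊).filter (fun d : ℕ => d₀ < d)) ×ˢ
      (Finset.Icc 1 ⌊T⌋₊ ×ˢ Finset.Icc 1 ⌊T⌋₊))
    (fun i n => (i.1 * i.2.1 + 1).Prime ∧ (i.1 * i.2.2 + 1).Prime ∧
      i.1 * i.2.1 + 1 ≠ i.1 * i.2.2 + 1 ∧ i.1 * i.2.1 + 1 ∣ n ∧
      ((i.1 * i.2.2 + 1 : ℕ) : ℤ) ∣ n + k ∧ (i.1 : ℝ) ^ 2 * i.2.1 * i.2.2 ≤ T)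
    (fun i => (x + T) * (((i.1 : ℝ) ^ 2)⁻¹ * ((i.2.1 : ℝ)⁻¹ * (i.2.2 : ℝ)⁻¹))) ?_ ?_
  · rw [← Finset.mul_sum, Finset.sum_product] at h
    simp only [← Finset.mul_sum, Finset.sum_product, ← Finset.sum_mul] at h
    refine h.trans ?_
    have h1 := sum_inv_sq_le hd ⌊T⌋₊
    have h2 := sum_inv_Icc_floor_le hT
    calc _ ≤ (x + T) * ((2 / d₀) * ((1 + Real.log T) * (1 + Real.log T))) := by
          have : (0 : ℝ) ≤ ∑ a ∈ Finset.Icc 1 ⌊T⌋₊, (a : ℝ)⁻¹ :=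
            Finset.sum_nonneg fun _ _ => by positivity
          gcongr
      _ = _ := by ring
  · intro n hn
    obtain ⟨hnx, p, q, d, hp, hq, hpq, hpn, hqn, hd', hdp, hdq, hT'⟩ := hS n hn
    obtain ⟨a, ha, rfl⟩ := exists_eq_mul_add_one hp hdp
    obtain ⟨b, hb, rfl⟩ := exists_eq_mul_add_one hq hdq
    have hd1 : 1 ≤ d := by exact_mod_cast hd.trans hd'
    have hle : (d : ℝ) ^ 2 * a * b ≤ T := by
      refine le_trans ?_ hT'
      have : d ^ 2 * a * b ≤ (d * a + 1) * (d * b + 1) := by nlinarith [Nat.zero_le (d*a+d*b)]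
      exact_mod_cast this
    refine ⟨(d, a, b), ?_, hp, hq, hpq, hpn, hqn, hle⟩
    have hnat : d ^ 2 * a * b ≤ ⌊T⌋₊ := Nat.le_floor (by exact_mod_cast hle)
    have e1 : d ≤ d ^ 2 * a * b := by
      calc d = d * 1 * 1 * 1 := by ring
        _ ≤ d * d * a * b := by gcongr
        _ = _ := by ring
    have e2 : a ≤ d ^ 2 * a * b := by
      calc a = 1 * a * 1 := by ring
        _ ≤ d ^ 2 * a * b := by gcongr; exact Nat.one_le_pow _ _ hd1
    have e3 : b ≤ d ^ 2 * a * b := by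
      calc b = 1 * 1 * b := by ring
        _ ≤ d ^ 2 * a * b := by gcongr; exact Nat.one_le_pow _ _ hd1
    simp only [Finset.mem_product, Finset.mem_filter, Finset.mem_Icc]
    exact ⟨⟨⟨hd1, e1.trans hnat⟩, hd'⟩, ⟨ha, e2.trans hnat⟩, ⟨hb, e3.trans hnat⟩⟩
  · rintro ⟨d, a, b⟩ hi U hU hP
    simp only [Finset.mem_product, Finset.mem_filter, Finset.mem_Icc] at hi
    obtain ⟨⟨⟨hd1, -⟩, -⟩, ⟨ha, -⟩, ⟨hb, -⟩⟩ := hi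
    have hd0 : (0 : ℝ) < d := by exact_mod_cast hd1
    have ha0 : (0 : ℝ) < a := by exact_mod_cast ha
    have hb0 : (0 : ℝ) < b := by exact_mod_cast hb
    rcases U.eq_empty_or_nonempty with rfl | ⟨n₀, hn₀⟩
    · simp only [Finset.card_empty, Nat.cast_zero]; positivity
    obtain ⟨hp, hq, hpq, -, -, hle⟩ := hP n₀ hn₀
    simp only at hp hq hpq hle
    -- The conditions p ∣ n and q ∣ n + k fix n modulo pq. The rounding term 1 is absorbed by
    -- T/(d²ab), since d²ab ≤ pq ≤ T.
    have hcard := card_le_of_modEq (S := U) (x := x) (h := (d * a + 1) * (d * b + 1))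
      (by positivity) hx (fun n hn => (hS n (hU hn)).1) (by
        intro n hn n' hn'
        obtain ⟨-, -, -, h1, h2, -⟩ := hP n hn
        obtain ⟨-, -, -, h3, h4, -⟩ := hP n' hn'
        rw [← Nat.modEq_and_modEq_iff_modEq_mul ((Nat.coprime_primes hp hq).2 hpq)]
        refine ⟨((Nat.modEq_zero_iff_dvd).2 h1).trans ((Nat.modEq_zero_iff_dvd).2 h3).symm, ?_⟩
        rw [← Int.natCast_modEq_iff]
        apply Int.ModEq.symm
        rw [Int.modEq_iff_dvd]
        have := dvd_sub h2 h4
        rwa [add_sub_add_right_eq_sub] at this)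
    refine hcard.trans ?_
    have hpos : 0 < (d : ℝ) ^ 2 * a * b := by positivity
    have e1 : x / (((d * a + 1) * (d * b + 1) : ℕ) : ℝ) ≤ x / ((d : ℝ) ^ 2 * a * b) := by
      apply div_le_div_of_nonneg_left hx hpos
      have : d ^ 2 * a * b ≤ (d * a + 1) * (d * b + 1) := by nlinarith [Nat.zero_le (d*a+d*b)]
      exact_mod_cast this
    have e2 : 1 ≤ T / ((d : ℝ) ^ 2 * a * b) := by rwa [one_le_div hpos]
    calc _ ≤ x / ((d : ℝ) ^ 2 * a * b) + T / ((d : ℝ) ^ 2 * a * b) := add_le_add e1 e2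
      _ = _ := by simp only [mul_inv, div_eq_mul_inv]; ring

/-- Few `n` have prime factors `p ∣ n`, `q ∣ n + k` with `q` much smaller than `p` and
`gcd (p - 1) (q - 1)` large. -/
theorem card_le_of_common_divisor_of_mul_le {S : Finset ℕ} {k : ℤ} {x B d₀ : ℝ} (hd : 0 < d₀)
    (hx : 1 ≤ x) (hB : 1 ≤ B)
    (hS : ∀ n ∈ S, 1 ≤ n ∧ (n : ℝ) ≤ x ∧ ∃ p q d : ℕ, p.Prime ∧ q.Prime ∧ p ∣ n ∧
      (q : ℤ) ∣ n + k ∧ ¬ (q : ℤ) ∣ k ∧ d₀ < d ∧ d ∣ p - 1 ∧ d ∣ q - 1 ∧ (q : ℝ) * B ≤ p) :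
    (S.card : ℝ) ≤ 2 * x * (1 + Real.log x) ^ 2 / d₀ + x / B * (1 + Real.log x) ^ 3 := by
  have hlT : 0 ≤ Real.log x := Real.log_nonneg hx
  have h := card_le_sum_of_cover (S := S)
    (((Finset.Icc 1 ⌊x⌋₊).filter (fun d : ℕ => d₀ < d)) ×ˢ
      (Finset.Icc 1 ⌊x⌋₊ ×ˢ Finset.Icc 1 ⌊x⌋₊))
    (fun i n => (i.1 * i.2.1 + 1).Prime ∧ ((i.1 * i.2.1 + 1 : ℕ) : ℤ) ∣ n + k ∧
      ¬ ((i.1 * i.2.1 + 1 : ℕ) : ℤ) ∣ k ∧ (∃ p, p.Prime ∧ i.1 ∣ p - 1 ∧ n = p * i.2.2) ∧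
      (i.1 : ℝ) * i.2.1 * i.2.2 ≤ x / B)
    (fun i => x * (((i.1 : ℝ) ^ 2)⁻¹ * ((i.2.1 : ℝ)⁻¹ * (i.2.2 : ℝ)⁻¹)) +
      (x / B) * ((i.1 : ℝ)⁻¹ * ((i.2.1 : ℝ)⁻¹ * (i.2.2 : ℝ)⁻¹))) ?_ ?_
  · rw [Finset.sum_add_distrib, ← Finset.mul_sum, ← Finset.mul_sum, Finset.sum_product,
      Finset.sum_product] at h
    simp only [← Finset.mul_sum, Finset.sum_product, ← Finset.sum_mul] at h
    refine h.trans ?_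
    have h1 := sum_inv_sq_le hd ⌊x⌋₊
    have h2 := sum_inv_Icc_floor_le hx
    have h3 : ∑ d ∈ (Finset.Icc 1 ⌊x⌋₊).filter (fun d : ℕ => d₀ < d), (d : ℝ)⁻¹ ≤
        1 + Real.log x :=
      (Finset.sum_le_sum_of_subset_of_nonneg (Finset.filter_subset _ _)
        fun _ _ _ => by positivity).trans h2
    calc _ ≤ x * ((2 / d₀) * ((1 + Real.log x) * (1 + Real.log x))) +
          (x / B) * ((1 + Real.log x) * ((1 + Real.log x) * (1 + Real.log x))) := by
          have : (0 : ℝ) ≤ ∑ a ∈ Finset.Icc 1 ⌊x⌋₊, (a : ℝ)⁻¹ :=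
            Finset.sum_nonneg fun _ _ => by positivity
          gcongr
      _ = _ := by ring
  · intro n hn
    obtain ⟨hn1, hnx, p, q, d, hp, hq, hpn, hqn, hqk, hd', hdp, hdq, hB'⟩ := hS n hn
    obtain ⟨b, hb, rfl⟩ := exists_eq_mul_add_one hq hdq
    obtain ⟨m, rfl⟩ := hpn
    have hm : 1 ≤ m := by
      rcases Nat.eq_zero_or_pos m with rfl | h
      · simp at hn1
      · exact h
    have hd1 : 1 ≤ d := by exact_mod_cast hd.trans hd'
    -- The imbalance between p and q enters only here; it pays for the rounding term of the residue
    -- class count.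
    have hle : (d : ℝ) * b * m ≤ x / B := by
      rw [le_div_iff₀ (by linarith)]
      push_cast at hnx hB'
      have hm0 : (0 : ℝ) < m := by exact_mod_cast hm
      calc (d : ℝ) * b * m * B ≤ (d * b + 1) * B * m := by nlinarith [mul_pos hm0 (by linarith : 0 < B)]
        _ ≤ p * m := by gcongr
        _ ≤ x := hnx
    refine ⟨(d, b, m), ?_, hq, hqn, hqk, ⟨p, hp, hdp, rfl⟩, hle⟩
    have hnat : d * b * m ≤ ⌊x⌋₊ := by
      apply Nat.le_floor
      have : x / B ≤ x := div_le_self (by linarith) hB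
      exact_mod_cast hle.trans this
    have e1 : d ≤ d * b * m := by
      calc d = d * 1 * 1 := by ring
        _ ≤ d * b * m := by gcongr
    have e2 : b ≤ d * b * m := by
      calc b = 1 * b * 1 := by ring
        _ ≤ d * b * m := by gcongr
    have e3 : m ≤ d * b * m := by
      calc m = 1 * 1 * m := by ring
        _ ≤ d * b * m := by gcongr
    simp only [Finset.mem_product, Finset.mem_filter, Finset.mem_Icc]
    exact ⟨⟨⟨hd1, e1.trans hnat⟩, hd'⟩, ⟨hb, e2.trans hnat⟩, ⟨hm, e3.trans hnat⟩⟩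
  · rintro ⟨d, b, m⟩ hi U hU hP
    simp only [Finset.mem_product, Finset.mem_filter, Finset.mem_Icc] at hi
    obtain ⟨⟨⟨hd1, -⟩, -⟩, ⟨hb, -⟩, ⟨hm, -⟩⟩ := hi
    have hd0 : (0 : ℝ) < d := by exact_mod_cast hd1
    have hb0 : (0 : ℝ) < b := by exact_mod_cast hb
    have hm0 : (0 : ℝ) < m := by exact_mod_cast hm
    rcases U.eq_empty_or_nonempty with rfl | ⟨n₀, hn₀⟩
    · simp only [Finset.card_empty, Nat.cast_zero]; positivity
    obtain ⟨hq, -, hqk, -, hle⟩ := hP n₀ hn₀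
    simp only at hq hqk hle
    -- Writing n = pm with p ≡ 1 mod d fixes n modulo dm, and q ∣ n + k fixes it modulo q. Here q =
    -- db + 1 is coprime to d, and to m because q ∤ k, so the modulus is qdm.
    have hcard := card_le_of_modEq (S := U) (x := x) (h := (d * b + 1) * d * m)
      (by positivity) (by linarith) (fun n hn => (hS n (hU hn)).2.1) (by
        intro n hn n' hn'
        obtain ⟨-, h2, -, ⟨p, hp, hdp, rfl⟩, -⟩ := hP n hn
        obtain ⟨-, h4, -, ⟨p', hp', hdp', rfl⟩, -⟩ := hP n' hn'
        simp only at h2 h4 hdp hdp' ⊢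
        apply Nat.ModEq.mul_right' m
        have hcop : Nat.Coprime (d * b + 1) d := by simp
        rw [← Nat.modEq_and_modEq_iff_modEq_mul hcop]
        constructor
        · have hmq : Nat.Coprime (d * b + 1) m := by
            rw [Nat.Prime.coprime_iff_not_dvd hq]
            intro hqm
            apply hqk
            have h5 : ((d * b + 1 : ℕ) : ℤ) ∣ ((p * m : ℕ) : ℤ) := by
              exact_mod_cast hqm.mul_left p
            exact (dvd_add_right h5).1 h2
          apply Nat.ModEq.cancel_right_of_coprime (c := m) hmq
          rw [← Int.natCast_modEq_iff]
          apply Int.ModEq.symm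
          rw [Int.modEq_iff_dvd]
          have := dvd_sub h2 h4
          rwa [add_sub_add_right_eq_sub] at this
        · exact ((Nat.modEq_iff_dvd' hp.one_le).2 hdp).symm.trans
            ((Nat.modEq_iff_dvd' hp'.one_le).2 hdp'))
    refine hcard.trans ?_
    have hpos : 0 < (d : ℝ) ^ 2 * b * m := by positivity
    have e1 : x / (((d * b + 1) * d * m : ℕ) : ℝ) ≤ x / ((d : ℝ) ^ 2 * b * m) := by
      apply div_le_div_of_nonneg_left (by linarith) hpos
      have : d ^ 2 * b * m ≤ (d * b + 1) * d * m := by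
        apply Nat.mul_le_mul_right; nlinarith
      exact_mod_cast this
    have e2 : 1 ≤ (x / B) / ((d : ℝ) * b * m) := by rwa [one_le_div (by positivity)]
    calc _ ≤ x / ((d : ℝ) ^ 2 * b * m) + (x / B) / ((d : ℝ) * b * m) := add_le_add e1 e2
      _ = _ := by simp only [mul_inv, div_eq_mul_inv]; ring

/-- Few solutions `n` of `φ(n) = φ(n + k)` have prime factors `p ∣ n`, `q ∣ n + k` with `p q`
large. -/
theorem card_le_of_large_prime_factors {S : Finset ℕ} {k : ℤ} (hk : Odd k) {M : ℝ}
    (hM : 1 ≤ M)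
    (hS : ∀ n ∈ S, 1 ≤ n ∧ n.totient = ((n : ℤ) + k).toNat.totient ∧
      ∃ p q m m' : ℕ, p.Prime ∧ q.Prime ∧ p ≠ 2 ∧ q ≠ 2 ∧ ¬ p ∣ m ∧ ¬ q ∣ m' ∧ n = p * m ∧
        (n : ℤ) + k = ((q * m' : ℕ) : ℤ) ∧ (m : ℝ) * m' ≤ M) :
    (S.card : ℝ) ≤ M * (1 + Real.log M) ^ 2 := by
  have h := card_le_sum_of_cover (S := S) (Finset.Icc 1 ⌊M⌋₊ ×ˢ Finset.Icc 1 ⌊M⌋₊)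
    (fun i n => ∃ p q : ℕ, p.Prime ∧ q.Prime ∧ p ≠ 2 ∧ q ≠ 2 ∧ ¬ p ∣ i.1 ∧ ¬ q ∣ i.2 ∧
      n = p * i.1 ∧ (n : ℤ) + k = ((q * i.2 : ℕ) : ℤ) ∧ (i.1 : ℝ) * i.2 ≤ M)
    (fun i => M * ((i.1 : ℝ)⁻¹ * (i.2 : ℝ)⁻¹)) ?_ ?_
  · rw [← Finset.mul_sum, Finset.sum_product] at h
    simp only [← Finset.mul_sum, ← Finset.sum_mul] at h
    refine h.trans ?_
    have h2 := sum_inv_Icc_floor_le hM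
    have : (0 : ℝ) ≤ ∑ a ∈ Finset.Icc 1 ⌊M⌋₊, (a : ℝ)⁻¹ :=
      Finset.sum_nonneg fun _ _ => by positivity
    rw [← sq]
    gcongr
  · intro n hn
    obtain ⟨-, -, p, q, m, m', hp, hq, hp2, hq2, hpm, hqm, h1, h2, h3⟩ := hS n hn
    refine ⟨(m, m'), ?_, p, q, hp, hq, hp2, hq2, hpm, hqm, h1, h2, h3⟩
    have hm : 1 ≤ m := Nat.pos_of_ne_zero fun h => hpm (h ▸ dvd_zero p)
    have hm' : 1 ≤ m' := Nat.pos_of_ne_zero fun h => hqm (h ▸ dvd_zero q)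
    have hnat : m * m' ≤ ⌊M⌋₊ := Nat.le_floor (by exact_mod_cast h3)
    simp only [Finset.mem_product, Finset.mem_Icc]
    exact ⟨⟨hm, (Nat.le_mul_of_pos_right m hm').trans hnat⟩,
      ⟨hm', (Nat.le_mul_of_pos_left m' hm).trans hnat⟩⟩
  · rintro ⟨m, m'⟩ hi U hU hP
    simp only [Finset.mem_product, Finset.mem_Icc] at hi
    have hm0 : (0 : ℝ) < m := by exact_mod_cast hi.1.1
    have hm0' : (0 : ℝ) < m' := by exact_mod_cast hi.2.1
    rcases U.eq_empty_or_nonempty with rfl | ⟨n₀, hn₀⟩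
    · simp only [Finset.card_empty, Nat.cast_zero]; positivity
    have hle : (m : ℝ) * m' ≤ M := by
      obtain ⟨p, q, -, -, -, -, -, -, -, -, h⟩ := hP n₀ hn₀
      exact h
    -- A pair of cofactors (m, m') belongs to at most one solution, and M/(mm') ≥ 1 pays for it.
    have hcard : U.card ≤ 1 := by
      rw [Finset.card_le_one]
      intro n hn n' hn'
      have t := (hS n (hU hn)).2.1
      have t' := (hS n' (hU hn')).2.1
      obtain ⟨p, q, hp, hq, hp2, hq2, hpm, hqm, h1, h2, -⟩ := hP n hn
      obtain ⟨p', q', hp', hq', -, -, hpm', hqm', h1', h2', -⟩ := hP n' hn'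
      simp only at hpm hqm h1 h2 hpm' hqm' h1' h2'
      rw [h2, Int.toNat_natCast] at t
      rw [h2', Int.toNat_natCast] at t'
      subst h1 h1'
      push_cast at h2 h2'
      rw [eq_of_cofactors_eq hk (by omega) (by omega) hp hq hp' hq' hpm hqm hpm' hqm' hp2 hq2
        h2 h2' t t']
    have e2 : 1 ≤ M / ((m : ℝ) * m') := by rwa [one_le_div (by positivity)]
    calc (U.card : ℝ) ≤ 1 := by exact_mod_cast hcard
      _ ≤ _ := e2
      _ = _ := by simp only [mul_inv, div_eq_mul_inv]

/-! ### Rough parts of p - 1. -/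

/-- The largest divisor of `n` all of whose prime factors exceed `y`. -/
noncomputable def roughPart (y : ℝ) : ℕ →* ℕ := by
  classical exact primeMulHom fun r : ℕ => if y < r then r else 1

open Classical in
theorem roughPart_apply (y : ℝ) {n : ℕ} (hn : n ≠ 0) :
    roughPart y n = (n.primeFactorsList.map fun r : ℕ => if y < r then r else 1).prod :=
  primeMulHom_apply _ hn

theorem one_le_roughPart (y : ℝ) {n : ℕ} (hn : n ≠ 0) : 1 ≤ roughPart y n := by
  classical
  apply one_le_primeMulHom _ hn
  intro p hp
  split_ifs
  · exact hp.one_le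
  · exact le_rfl

theorem roughPart_dvd (y : ℝ) {n : ℕ} (hn : n ≠ 0) : roughPart y n ∣ n := by
  classical
  rw [roughPart_apply y hn]
  conv_rhs => rw [← Nat.prod_primeFactorsList hn]
  induction n.primeFactorsList with
  | nil => simp
  | cons a l ih =>
    simp only [List.map_cons, List.prod_cons]
    apply mul_dvd_mul _ ih
    split_ifs
    · exact dvd_rfl
    · exact one_dvd a

theorem lt_of_prime_dvd_roughPart {y : ℝ} {n r : ℕ} (hn : n ≠ 0) (hr : r.Prime)
    (h : r ∣ roughPart y n) : y < r := by
  classical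
  rw [roughPart_apply y hn, hr.prime.dvd_prod_iff] at h
  obtain ⟨a, ha, hra⟩ := h
  obtain ⟨p, hp, rfl⟩ := List.mem_map.1 ha
  split_ifs at hra with hy
  · rwa [(Nat.prime_dvd_prime_iff_eq hr (Nat.prime_of_mem_primeFactorsList hp)).1 hra]
  · exact absurd (Nat.dvd_one.1 hra) hr.one_lt.ne'

theorem gcd_prod_dvd_prod_gcd {ι : Type*} (s : Finset ι) (a : ℕ) (f : ι → ℕ) :
    Nat.gcd a (∏ i ∈ s, f i) ∣ ∏ i ∈ s, Nat.gcd a (f i) := by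
  classical
  induction s using Finset.induction_on with
  | empty => simp
  | insert i s hi ih =>
    rw [Finset.prod_insert hi, Finset.prod_insert hi]
    exact (Nat.gcd_mul_right_dvd_mul_gcd a (f i) (∏ i ∈ s, f i)).trans (mul_dvd_mul_left _ ih)

/-- In φ(N) = ∏ q^(e-1) (q - 1) the powers q^(e-1) are useless to a: for q > y the exponent is 0,
and for q ≤ y the prime q does not divide a. -/
theorem dvd_prod_gcd_of_dvd_totient {a N : ℕ} {y : ℝ} (ha : ∀ r : ℕ, r.Prime → r ∣ a → y < r)
    (hN : ∀ q : ℕ, q.Prime → y < q → ¬ q ^ 2 ∣ N) (hN0 : N ≠ 0) (h : a ∣ N.totient) :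
    a ∣ ∏ q ∈ N.primeFactors, Nat.gcd a (q - 1) := by
  rw [Nat.totient_eq_prod_factorization hN0] at h
  rw [Finsupp.prod, Nat.support_factorization] at h
  have h1 := gcd_prod_dvd_prod_gcd N.primeFactors a
    (fun q => q ^ (N.factorization q - 1) * (q - 1))
  rw [Nat.gcd_eq_left h] at h1
  refine h1.trans (Finset.prod_dvd_prod_of_dvd _ _ fun q hq => ?_)
  have hqp := Nat.prime_of_mem_primeFactors hq
  have hcop : Nat.Coprime a (q ^ (N.factorization q - 1)) := by
    by_cases hy : y < q
    · have : N.factorization q < 2 := by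
        by_contra hcon
        exact hN q hqp hy ((hqp.pow_dvd_iff_le_factorization hN0).2 (not_lt.1 hcon))
      rw [show N.factorization q - 1 = 0 by omega, pow_zero]
      exact Nat.coprime_one_right a
    · apply Nat.Coprime.pow_right
      rw [Nat.coprime_comm, Nat.Prime.coprime_iff_not_dvd hqp]
      exact fun hqa => hy (ha q hqp hqa)
  exact (hcop.symm.gcd_mul_left_cancel_right _).dvd

-- Three prime factors above c, counted with multiplicity, would already multiply to at least c³.
open Classical in
theorem length_filter_primeFactorsList_le {N : ℕ} {c : ℝ} (hN : N ≠ 0) (hc : 1 ≤ c)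
    (h : (N : ℝ) < c ^ 3) : (N.primeFactorsList.filter fun p : ℕ => c < p).length ≤ 2 := by
  set l := N.primeFactorsList.filter fun p : ℕ => c < p with hl
  by_contra hlen
  have hdvd : l.prod ∣ N := by
    conv_rhs => rw [← Nat.prod_primeFactorsList hN]
    exact List.Sublist.prod_dvd_prod List.filter_sublist
  have hle := Nat.le_of_dvd (Nat.pos_of_ne_zero hN) hdvd
  have hmem : ∀ p ∈ l, c ≤ p := by
    intro p hp
    have := (List.mem_filter.1 hp).2
    exact (by simpa using this : c < p).le
  have hpow : ∀ l : List ℕ, (∀ p ∈ l, c ≤ p) → c ^ l.length ≤ (l.prod : ℝ) := by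
    intro l
    induction l with
    | nil => simp
    | cons a l ih =>
      intro hl
      rw [List.length_cons, List.prod_cons, pow_succ', Nat.cast_mul]
      have h1 := hl a (by simp)
      have h2 := ih fun p hp => hl p (by simp [hp])
      gcongr
  have h1 := hpow l hmem
  have h2 : c ^ 3 ≤ c ^ l.length := pow_le_pow_right₀ hc (by omega)
  have h3 : (l.prod : ℝ) ≤ N := by exact_mod_cast hle
  linarith

open Classical in
theorem prod_map_le_pow_length_filter (l : List ℕ) (f : ℕ → ℕ) {c E : ℝ} (hE : 0 ≤ E)
    (h1 : ∀ p ∈ l, c < p → (f p : ℝ) ≤ E) (h2 : ∀ p ∈ l, ¬ c < p → (f p : ℝ) ≤ 1) :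
    ((l.map f).prod : ℝ) ≤ E ^ (l.filter fun p : ℕ => c < p).length := by
  induction l with
  | nil => simp
  | cons a l ih =>
    have ih' := ih (fun p hp => h1 p (by simp [hp])) (fun p hp => h2 p (by simp [hp]))
    rw [List.map_cons, List.prod_cons, Nat.cast_mul]
    by_cases ha : c < a
    · rw [List.filter_cons_of_pos (by simpa using ha), List.length_cons, pow_succ']
      have := h1 a (by simp) ha
      gcongr
    · rw [List.filter_cons_of_neg (by simpa using ha)]
      have := h2 a (by simp) ha
      calc _ ≤ 1 * E ^ (l.filter fun p : ℕ => c < p).length := by gcongr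
        _ = _ := one_mul _

/-- If only large primes `p ∣ n`, `q ∣ N` have `gcd (p - 1) (q - 1)` large, and `φ(n) = φ(N)`,
then the `B`-rough part of `∏ (p - 1)` over the primes dividing `n` is small. -/
theorem primeMulHom_roughPart_le {n N : ℕ} {B D c : ℝ} (hn : n ≠ 0) (hN : N ≠ 0)
    (hφ : n.totient = N.totient) (hD : 1 ≤ D) (hc : 1 ≤ c)
    (hnc : (n : ℝ) < c ^ 3) (hNc : (N : ℝ) < c ^ 3)
    (hsq : ∀ q : ℕ, q.Prime → B < q → ¬ q ^ 2 ∣ N)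
    (hbig : ∀ p q : ℕ, p.Prime → q.Prime → p ∣ n → q ∣ N → B < (Nat.gcd (p - 1) (q - 1) : ℕ) →
      c < p ∧ c < q ∧ ((Nat.gcd (p - 1) (q - 1) : ℕ) : ℝ) ≤ D) :
    (primeMulHom (fun p => roughPart B (p - 1)) n : ℝ) ≤ D ^ 4 := by
  classical
  have hgcd : ∀ p q, p.Prime → q.Prime → p ∣ n → q ∣ N →
      Nat.gcd (roughPart B (p - 1)) (q - 1) = 1 ∨
        (c < p ∧ c < q ∧ ((Nat.gcd (roughPart B (p - 1)) (q - 1) : ℕ) : ℝ) ≤ D) := by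
    intro p q hp hq hpn hqN
    have hp1 : p - 1 ≠ 0 := by have := hp.two_le; omega
    have hq1 : q - 1 ≠ 0 := by have := hq.two_le; omega
    by_cases h1 : Nat.gcd (roughPart B (p - 1)) (q - 1) = 1
    · exact Or.inl h1
    right
    -- A prime shared by the rough part and q - 1 exceeds B, so a single one makes `hbig`
    -- applicable.
    obtain ⟨r, hr, hrd⟩ := Nat.exists_prime_and_dvd h1
    have hrB := lt_of_prime_dvd_roughPart hp1 hr (hrd.trans (Nat.gcd_dvd_left _ _))
    have hdvd : Nat.gcd (roughPart B (p - 1)) (q - 1) ∣ Nat.gcd (p - 1) (q - 1) :=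
      Nat.gcd_dvd_gcd_of_dvd_left _ (roughPart_dvd B hp1)
    have hpos : 0 < Nat.gcd (p - 1) (q - 1) := Nat.gcd_pos_of_pos_left _ (Nat.pos_of_ne_zero hp1)
    have hle := Nat.le_of_dvd hpos hdvd
    have hle2 := Nat.le_of_dvd hpos (hrd.trans hdvd)
    have h3 := hbig p q hp hq hpn hqN (hrB.trans_le (by exact_mod_cast hle2))
    exact ⟨h3.1, h3.2.1, le_trans (by exact_mod_cast hle) h3.2.2⟩
  have hdvd : ∀ p, p.Prime → p ∣ n → roughPart B (p - 1) ∣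
      ∏ q ∈ N.primeFactors, Nat.gcd (roughPart B (p - 1)) (q - 1) := by
    intro p hp hpn
    have hp1 : p - 1 ≠ 0 := by have := hp.two_le; omega
    apply dvd_prod_gcd_of_dvd_totient (fun r hr h => lt_of_prime_dvd_roughPart hp1 hr h) hsq hN
    rw [← hφ]
    refine (roughPart_dvd B hp1).trans ?_
    rw [← Nat.totient_prime hp]
    exact Nat.totient_dvd_of_dvd hpn
  have hcard : (N.primeFactors.filter fun q : ℕ => c < q).card ≤ 2 := by
    have : N.primeFactors.filter (fun q : ℕ => c < q) =
        (N.primeFactorsList.filter fun p : ℕ => c < p).toFinset := by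
      ext q; simp
    rw [this]
    exact (List.toFinset_card_le _).trans (length_filter_primeFactorsList_le hN hc hNc)
  -- For p ≤ c every gcd is 1, so the rough part is trivial. For p > c (`hR2`) at most two primes q
  -- > c contribute, each at most D.
  have hR1 : ∀ p ∈ n.primeFactorsList, ¬ c < p → ((roughPart B (p - 1) : ℕ) : ℝ) ≤ 1 := by
    intro p hp hcp
    have hpp := Nat.prime_of_mem_primeFactorsList hp
    have hpn := Nat.dvd_of_mem_primeFactorsList hp
    have h1 := hdvd p hpp hpn
    rw [Finset.prod_eq_one fun q hq => ?_] at h1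
    · exact_mod_cast Nat.le_of_dvd one_pos h1
    · rcases hgcd p q hpp (Nat.prime_of_mem_primeFactors hq) hpn
        (Nat.dvd_of_mem_primeFactors hq) with h | h
      · exact h
      · exact absurd h.1 hcp
  have hR2 : ∀ p ∈ n.primeFactorsList, c < p → ((roughPart B (p - 1) : ℕ) : ℝ) ≤ D ^ 2 := by
    intro p hp _
    have hpp := Nat.prime_of_mem_primeFactorsList hp
    have hpn := Nat.dvd_of_mem_primeFactorsList hp
    have hle : roughPart B (p - 1) ≤
        ∏ q ∈ N.primeFactors, Nat.gcd (roughPart B (p - 1)) (q - 1) := by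
      refine Nat.le_of_dvd (Finset.prod_pos fun q hq => ?_) (hdvd p hpp hpn)
      apply Nat.gcd_pos_of_pos_right
      have := (Nat.prime_of_mem_primeFactors hq).two_le
      omega
    calc ((roughPart B (p - 1) : ℕ) : ℝ)
        ≤ ∏ q ∈ N.primeFactors, ((Nat.gcd (roughPart B (p - 1)) (q - 1) : ℕ) : ℝ) := by
          rw [← Nat.cast_prod]; exact_mod_cast hle
      _ ≤ ∏ q ∈ N.primeFactors, (if c < q then D else 1) := by
          refine Finset.prod_le_prod (fun _ _ => by positivity) fun q hq => ?_
          rcases hgcd p q hpp (Nat.prime_of_mem_primeFactors hq) hpn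
            (Nat.dvd_of_mem_primeFactors hq) with h | h
          · rw [h]; split_ifs <;> simp [hD]
          · rw [if_pos h.2.1]; exact h.2.2
      _ = D ^ (N.primeFactors.filter fun q : ℕ => c < q).card := by
          rw [Finset.prod_ite, Finset.prod_const_one, mul_one, Finset.prod_const]
      _ ≤ D ^ 2 := pow_le_pow_right₀ hD hcard
  -- At most two primes p > c occur in n, with multiplicity, each contributing at most D².
  rw [primeMulHom_apply _ hn]
  calc _ ≤ (D ^ 2) ^ (n.primeFactorsList.filter fun p : ℕ => c < p).length :=
        prod_map_le_pow_length_filter _ _ (by positivity) hR2 hR1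
    _ ≤ (D ^ 2) ^ 2 := pow_le_pow_right₀ (one_le_pow₀ hD)
        (length_filter_primeFactorsList_le hn hc hnc)
    _ = D ^ 4 := by ring

/-! ### Rankin's method and its Euler product. -/

theorem prime_rpow_neg_le {p : ℕ} (hp : p.Prime) {s : ℝ} (hs : 1 / 2 ≤ s) :
    (p : ℝ) ^ (-s) ≤ 3 / 4 := by
  have hp2 : (2 : ℝ) ≤ p := by exact_mod_cast hp.two_le
  calc (p : ℝ) ^ (-s) ≤ (p : ℝ) ^ (-(1 / 2) : ℝ) :=
        Real.rpow_le_rpow_of_exponent_le (by linarith) (by linarith)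
    _ ≤ (2 : ℝ) ^ (-(1 / 2) : ℝ) :=
        Real.rpow_le_rpow_of_nonpos (by norm_num) hp2 (by norm_num)
    _ = (√2)⁻¹ := by rw [Real.rpow_neg (by norm_num), Real.sqrt_eq_rpow]
    _ ≤ 3 / 4 := by
        rw [inv_le_comm₀ (by positivity) (by norm_num)]
        exact Real.le_sqrt_of_sq_le (by norm_num)

/-- The ratio (1 - b)/(1 - a) is 1 + (a - b)/(1 - a), and a ≤ 3/4 gives 1/(1 - a) ≤ 4. This is the
source of the factor 4 in the exponentials below. -/
theorem inv_one_sub_le_mul_exp {a b : ℝ} (hba : b ≤ a) (ha : a ≤ 3 / 4) :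
    (1 - a)⁻¹ ≤ (1 - b)⁻¹ * Real.exp (4 * (a - b)) := by
  have h := Real.add_one_le_exp (4 * (a - b))
  rw [inv_mul_eq_div, le_div_iff₀ (by linarith), inv_mul_eq_div, div_le_iff₀ (by linarith)]
  calc 1 - b ≤ (4 * (a - b) + 1) * (1 - a) := by nlinarith
    _ ≤ _ := mul_le_mul_of_nonneg_right h (by linarith)

/-- Rankin's method for the integers with small rough part of `∏ (p - 1)`. -/
theorem card_le_rankin {S : Finset ℕ} {x y s α Q : ℝ} (hx : 0 ≤ x) (hs : 1 / 2 ≤ s) (hα : 0 ≤ α)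
    (hQ0 : 0 ≤ Q) (hS : ∀ n ∈ S, 1 ≤ n ∧ (n : ℝ) ≤ x ∧
      (primeMulHom (fun p => roughPart y (p - 1)) n : ℝ) ≤ Q) :
    (S.card : ℝ) ≤ x ^ s * Q ^ α * Real.exp (4 * ∑ p ∈ (⌊x⌋₊ + 1).primesBelow,
      (p : ℝ) ^ (-s) * ((roughPart y (p - 1) : ℕ) : ℝ) ^ (-α)) := by
  set H : ℕ → ℕ := fun p => roughPart y (p - 1) with hH
  set g : ℕ → ℝ := fun p => (p : ℝ) ^ (-s) * (H p : ℝ) ^ (-α) with hg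
  have hH1 : ∀ p, p.Prime → 1 ≤ H p := fun p hp =>
    one_le_roughPart y (by have := hp.two_le; omega)
  have hg0 : ∀ p, p.Prime → 0 ≤ g p := fun p _ => by positivity
  have hg1 : ∀ p, p.Prime → g p ≤ 3 / 4 := by
    intro p hp
    have h1 : (H p : ℝ) ^ (-α) ≤ 1 :=
      Real.rpow_le_one_of_one_le_of_nonpos (by exact_mod_cast hH1 p hp) (by linarith)
    calc g p ≤ (p : ℝ) ^ (-s) * 1 := mul_le_mul_of_nonneg_left h1 (by positivity)
      _ ≤ 3 / 4 := by rw [mul_one]; exact prime_rpow_neg_le hp hs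
  have hsum := sum_primeMulHom_le_prod hg0 (fun p hp => (hg1 p hp).trans_lt (by norm_num)) ⌊x⌋₊
  have hprod : ∏ p ∈ (⌊x⌋₊ + 1).primesBelow, (1 - g p)⁻¹ ≤
      Real.exp (4 * ∑ p ∈ (⌊x⌋₊ + 1).primesBelow, g p) := by
    rw [Finset.mul_sum, Real.exp_sum]
    refine Finset.prod_le_prod (fun p hp => ?_) fun p hp => ?_
    · have := hg1 p (Nat.prime_of_mem_primesBelow hp)
      exact inv_nonneg.2 (by linarith)
    · have hp' := Nat.prime_of_mem_primesBelow hp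
      simpa using inv_one_sub_le_mul_exp (hg0 p hp') (hg1 p hp')
  -- Rankin's trick: the indicator of the set is at most (x/n)^s (Q/H(n))^α.
  have hterm : ∀ n ∈ S, (1 : ℝ) ≤ x ^ s * Q ^ α * primeMulHom g n := by
    intro n hn
    obtain ⟨hn1, hnx, hQ⟩ := hS n hn
    have hn0 : n ≠ 0 := by omega
    have hnpos : (0 : ℝ) < n := by exact_mod_cast hn1
    have hHn : (1 : ℝ) ≤ (primeMulHom H n : ℕ) := by
      exact_mod_cast one_le_primeMulHom hH1 hn0
    rw [hg, primeMulHom_mul_apply _ _ hn0, primeMulHom_rpow _ hn0,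
      primeMulHom_natCast_rpow _ _ hn0, Real.rpow_neg hnpos.le, Real.rpow_neg (by linarith)]
    have e1 : 1 ≤ x ^ s * ((n : ℝ) ^ s)⁻¹ := by
      rw [← div_eq_mul_inv, one_le_div (by positivity)]
      exact Real.rpow_le_rpow hnpos.le hnx (by linarith)
    have e2 : 1 ≤ Q ^ α * (((primeMulHom H n : ℕ) : ℝ) ^ α)⁻¹ := by
      rw [← div_eq_mul_inv, one_le_div (by positivity)]
      exact Real.rpow_le_rpow (by linarith) hQ hα
    calc (1 : ℝ) = 1 * 1 := by ring
      _ ≤ (x ^ s * ((n : ℝ) ^ s)⁻¹) * (Q ^ α * (((primeMulHom H n : ℕ) : ℝ) ^ α)⁻¹) := by gcongr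
      _ = _ := by ring
  have h0 : 0 ≤ x ^ s * Q ^ α := by positivity
  calc (S.card : ℝ) = ∑ n ∈ S, (1 : ℝ) := by simp
    _ ≤ ∑ n ∈ S, x ^ s * Q ^ α * primeMulHom g n := Finset.sum_le_sum hterm
    _ = x ^ s * Q ^ α * ∑ n ∈ S, primeMulHom g n := by rw [Finset.mul_sum]
    _ ≤ x ^ s * Q ^ α * ∑ n ∈ Finset.Icc 1 ⌊x⌋₊, primeMulHom g n := by
        apply mul_le_mul_of_nonneg_left _ h0
        apply Finset.sum_le_sum_of_subset_of_nonneg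
        · intro n hn
          have := hS n hn
          exact Finset.mem_Icc.2 ⟨this.1, Nat.le_floor this.2.1⟩
        · exact fun n _ _ => primeMulHom_nonneg hg0 n
    _ ≤ _ := mul_le_mul_of_nonneg_left (hsum.trans hprod) h0

/-- An Euler product bound by comparison with `ζ(1 + 1 / log y)`. -/
theorem prod_primesBelow_le {y η α : ℝ} (hy : 1 < y) (hη : 0 ≤ η) (hη2 : η ≤ 1 / 2)
    (hα : η + 1 / Real.log y ≤ α) (N : ℕ) (h : ℕ → ℝ)
    (h1 : ∀ p : ℕ, p.Prime → (p : ℝ) ≤ y → h p = (p : ℝ) ^ (-(1 - η)))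
    (h2 : ∀ p : ℕ, p.Prime → y < p → h p = (p : ℝ) ^ (-(1 - η)) * (p : ℝ) ^ (-α)) :
    ∏ p ∈ N.primesBelow, (1 - h p)⁻¹ ≤ (1 + Real.log y) *
      Real.exp (4 * Real.exp (η * Real.log y) * ((Real.log y + Real.log 4) / Real.log y)) := by
  classical
  have hly : 0 < Real.log y := Real.log_pos hy
  set s := 1 + 1 / Real.log y with hs
  have hs1 : 1 < s := by have : 0 < 1 / Real.log y := by positivity
                         linarith
  set E := Real.exp (η * Real.log y) with hE
  have hterm : ∀ p ∈ N.primesBelow, (1 - h p)⁻¹ ≤ (1 - (p : ℝ) ^ (-s))⁻¹ *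
      Real.exp (if (p : ℝ) ≤ y then 4 * E / Real.log y * (Real.log p / p) else 0) := by
    intro p hp
    have hpp := Nat.prime_of_mem_primesBelow hp
    have hp0 : (0 : ℝ) < p := by exact_mod_cast hpp.pos
    have hp1 : (1 : ℝ) ≤ p := by exact_mod_cast hpp.one_le
    split_ifs with hpy
    · rw [h1 p hpp hpy]
      have hlp : 0 ≤ Real.log p := Real.log_nonneg hp1
      refine (inv_one_sub_le_mul_exp (b := (p : ℝ) ^ (-s)) ?_
        (prime_rpow_neg_le hpp (by linarith))).trans ?_
      · exact Real.rpow_le_rpow_of_exponent_le hp1 (by linarith)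
      · have hlt := rpow_neg_lt_one hpp (by linarith : 0 < s)
        apply mul_le_mul_of_nonneg_left _ (inv_nonneg.2 (by linarith))
        apply Real.exp_le_exp.2
        set t := Real.log p / Real.log y with ht
        have ht0 : 0 ≤ t := by positivity
        have ht1 : t ≤ 1 := by
          rw [ht, div_le_one hly]; exact Real.log_le_log hp0 hpy
        have e1 : (p : ℝ) ^ (-(1 - η)) = Real.exp (t * (η * Real.log y)) / p := by
          rw [Real.rpow_def_of_pos hp0, show Real.log p * -(1 - η) =
            t * (η * Real.log y) - Real.log p by rw [ht]; field_simp; ring, Real.exp_sub,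
            Real.exp_log hp0]
        have e2 : (p : ℝ) ^ (-s) = Real.exp (-t) / p := by
          rw [Real.rpow_def_of_pos hp0, show Real.log p * -s =
            -t - Real.log p by rw [ht, hs]; field_simp; ring, Real.exp_sub, Real.exp_log hp0]
        -- Convexity on t = log p / log y ∈ [0, 1]. Combined with exp(-t) ≥ 1 - t, it bounds the
        -- difference of the two exponentials by tE, so the sum over p ≤ y has weights log p / p and
        -- is controlled by Mertens.
        have c1 : Real.exp (t * (η * Real.log y)) ≤ (1 - t) + t * E := by
          have := convexOn_exp.2 (Set.mem_univ (0 : ℝ)) (Set.mem_univ (η * Real.log y))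
            (by linarith : (0 : ℝ) ≤ 1 - t) ht0 (by ring)
          simpa using this
        have c2 := Real.add_one_le_exp (-t)
        rw [e1, e2]
        calc 4 * (Real.exp (t * (η * Real.log y)) / p - Real.exp (-t) / p)
            = 4 / p * (Real.exp (t * (η * Real.log y)) - Real.exp (-t)) := by ring
          _ ≤ 4 / p * (t * E) := by
              apply mul_le_mul_of_nonneg_left _ (by positivity)
              linarith
          _ = _ := by rw [ht]; ring
    -- Above y the extra factor p^(-α) brings the term below p^(-s).
    · rw [not_le] at hpy
      rw [h2 p hpp hpy, ← Real.rpow_add hp0, Real.exp_zero, mul_one]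
      have hlt := rpow_neg_lt_one hpp (by linarith : 0 < s)
      apply inv_anti₀ (by linarith)
      have := Real.rpow_le_rpow_of_exponent_le hp1 (by linarith : -(1 - η) + -α ≤ -s)
      linarith
  calc ∏ p ∈ N.primesBelow, (1 - h p)⁻¹
      ≤ ∏ p ∈ N.primesBelow, ((1 - (p : ℝ) ^ (-s))⁻¹ *
        Real.exp (if (p : ℝ) ≤ y then 4 * E / Real.log y * (Real.log p / p) else 0)) := by
        refine Finset.prod_le_prod (fun p hp => ?_) hterm
        have hpp := Nat.prime_of_mem_primesBelow hp
        have hp1 : (1 : ℝ) ≤ p := by exact_mod_cast hpp.one_le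
        have hle := prime_rpow_neg_le hpp (by linarith : 1 / 2 ≤ 1 - η)
        apply inv_nonneg.2
        rcases le_or_gt (p : ℝ) y with hpy | hpy
        · rw [h1 p hpp hpy]; linarith
        · rw [h2 p hpp hpy]
          have hα0 : 0 ≤ α := le_trans (by positivity) hα
          have : (p : ℝ) ^ (-α) ≤ 1 := Real.rpow_le_one_of_one_le_of_nonpos hp1 (by linarith)
          have h0 : (0 : ℝ) ≤ (p : ℝ) ^ (-(1 - η)) := by positivity
          nlinarith
    _ = (∏ p ∈ N.primesBelow, (1 - (p : ℝ) ^ (-s))⁻¹) * Real.exp (∑ p ∈ N.primesBelow,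
        if (p : ℝ) ≤ y then 4 * E / Real.log y * (Real.log p / p) else 0) := by
        rw [Finset.prod_mul_distrib, Real.exp_sum]
    _ ≤ _ := by
        apply mul_le_mul _ _ (Real.exp_pos _).le (by linarith)
        · have := prod_primesBelow_one_sub_rpow_inv_le hs1 N
          rwa [hs, add_sub_cancel_left, one_div_one_div] at this
        · apply Real.exp_le_exp.2
          rw [← Finset.sum_filter, ← Finset.mul_sum]
          have hsub : N.primesBelow.filter (fun p : ℕ => (p : ℝ) ≤ y) ⊆
              (⌊y⌋₊ + 1).primesBelow := by
            intro p hp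
            rw [Finset.mem_filter] at hp
            rw [Nat.mem_primesBelow]
            exact ⟨Nat.lt_succ_of_le (Nat.le_floor hp.2), Nat.prime_of_mem_primesBelow hp.1⟩
          have hm : ∑ p ∈ N.primesBelow.filter (fun p : ℕ => (p : ℝ) ≤ y), Real.log p / p ≤
              Real.log y + Real.log 4 := by
            refine (Finset.sum_le_sum_of_subset_of_nonneg hsub fun p _ _ => ?_).trans
              ((sum_primes_log_div_le ⌊y⌋₊).trans ?_)
            · have := Real.log_natCast_nonneg p
              positivity
            · have : (0 : ℝ) < ⌊y⌋₊ := by exact_mod_cast (Nat.floor_pos.2 hy.le)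
              have := Real.log_le_log this (Nat.floor_le (by linarith))
              linarith
          calc _ ≤ 4 * E / Real.log y * (Real.log y + Real.log 4) := by gcongr
            _ = _ := by ring

/-- Below z the rough part is ignored and Mertens suffices. Above z a factor z^(-θ) is gained by
raising η to η + θ, and primality is given up so that the sum over m = p - 1 becomes an Euler
product. -/
theorem sum_prime_rpow_roughPart_le {y z η θ α : ℝ} (hy : 1 < y) (hz : 1 < z) (hη : 0 ≤ η)
    (hθ : 0 ≤ θ) (hηθ : η + θ ≤ 1 / 2) (hα : η + θ + 1 / Real.log y ≤ α) (N : ℕ) :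
    ∑ p ∈ (N + 1).primesBelow, (p : ℝ) ^ (-(1 - η)) *
        ((roughPart y (p - 1) : ℕ) : ℝ) ^ (-α) ≤
      z ^ η * (Real.exp 1 * Real.log (1 + Real.log z)) + z ^ (-θ) * ((1 + Real.log y) *
      Real.exp (4 * Real.exp ((η + θ) * Real.log y) *
        ((Real.log y + Real.log 4) / Real.log y))) := by
  classical
  have hly : 0 < Real.log y := Real.log_pos hy
  have hα0 : 0 ≤ α := le_trans (by positivity) hα
  set g : ℕ → ℝ := fun p => (p : ℝ) ^ (-(1 - η)) * ((roughPart y (p - 1) : ℕ) : ℝ) ^ (-α) with hg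
  have hg0 : ∀ p, 0 ≤ g p := fun p => by positivity
  rw [← Finset.sum_filter_add_sum_filter_not _ (fun p : ℕ => (p : ℝ) ≤ z)]
  apply add_le_add
  · have hsub : (N + 1).primesBelow.filter (fun p : ℕ => (p : ℝ) ≤ z) ⊆
        (⌊z⌋₊ + 1).primesBelow := by
      intro p hp
      rw [Finset.mem_filter] at hp
      rw [Nat.mem_primesBelow]
      exact ⟨Nat.lt_succ_of_le (Nat.le_floor hp.2), Nat.prime_of_mem_primesBelow hp.1⟩
    refine (Finset.sum_le_sum_of_subset_of_nonneg hsub fun p _ _ => hg0 p).trans ?_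
    refine le_trans ?_ (mul_le_mul_of_nonneg_left (sum_primes_inv_le hz)
      (by positivity : 0 ≤ z ^ η))
    rw [Finset.mul_sum]
    apply Finset.sum_le_sum
    intro p hp
    have hpp := Nat.prime_of_mem_primesBelow hp
    have hp0 : (0 : ℝ) < p := by exact_mod_cast hpp.pos
    have hpz : (p : ℝ) ≤ z := by
      have := Nat.lt_of_mem_primesBelow hp
      exact (Nat.le_floor_iff (by linarith)).1 (by omega)
    have h1 : ((roughPart y (p - 1) : ℕ) : ℝ) ^ (-α) ≤ 1 := by
      apply Real.rpow_le_one_of_one_le_of_nonpos _ (by linarith)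
      exact_mod_cast one_le_roughPart y (by have := hpp.two_le; omega)
    calc g p ≤ (p : ℝ) ^ (-(1 - η)) * 1 := mul_le_mul_of_nonneg_left h1 (by positivity)
      _ = (p : ℝ) ^ η * (p : ℝ)⁻¹ := by
          rw [mul_one, ← Real.rpow_neg_one, ← Real.rpow_add hp0]; congr 1; ring
      _ ≤ z ^ η * (p : ℝ)⁻¹ := by gcongr
  · set h : ℕ → ℝ := fun r => (r : ℝ) ^ (-(1 - (η + θ))) *
      ((if y < r then r else 1 : ℕ) : ℝ) ^ (-α) with hh
    have hh0 : ∀ r, r.Prime → 0 ≤ h r := fun r _ => by positivity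
    have hh1 : ∀ r, r.Prime → h r < 1 := by
      intro r hr
      have hle : ((if y < r then r else 1 : ℕ) : ℝ) ^ (-α) ≤ 1 := by
        apply Real.rpow_le_one_of_one_le_of_nonpos _ (by linarith)
        split_ifs
        · exact_mod_cast hr.one_le
        · simp
      calc h r ≤ (r : ℝ) ^ (-(1 - (η + θ))) * 1 :=
          mul_le_mul_of_nonneg_left hle (by positivity)
        _ ≤ 3 / 4 := by rw [mul_one]; exact prime_rpow_neg_le hr (by linarith)
        _ < 1 := by norm_num
    have hE := prod_primesBelow_le hy (by positivity) hηθ hα (N + 1) h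
      (fun p _ hpy => by simp [hh, not_lt.2 hpy]) (fun p _ hpy => by simp [hh, hpy])
    have hs := (sum_primeMulHom_le_prod hh0 hh1 N).trans hE
    refine le_trans ?_ (mul_le_mul_of_nonneg_left hs (by positivity))
    have hterm : ∀ p ∈ (N + 1).primesBelow.filter (fun p : ℕ => ¬ (p : ℝ) ≤ z),
        g p ≤ z ^ (-θ) * primeMulHom h (p - 1) := by
      intro p hp
      rw [Finset.mem_filter, not_le] at hp
      have hpp := Nat.prime_of_mem_primesBelow hp.1
      have hp0 : (0 : ℝ) < p := by exact_mod_cast hpp.pos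
      have hp1 : p - 1 ≠ 0 := by have := hpp.two_le; omega
      have hp1' : (0 : ℝ) < ((p - 1 : ℕ) : ℝ) := by exact_mod_cast Nat.pos_of_ne_zero hp1
      rw [hh, primeMulHom_mul_apply _ _ hp1, primeMulHom_rpow _ hp1,
        primeMulHom_natCast_rpow _ _ hp1]
      have e : (p : ℝ) ^ (-(1 - η)) = (p : ℝ) ^ (-θ) * (p : ℝ) ^ (-(1 - (η + θ))) := by
        rw [← Real.rpow_add hp0]; congr 1; ring
      have e1 : (p : ℝ) ^ (-θ) ≤ z ^ (-θ) :=
        Real.rpow_le_rpow_of_nonpos (by linarith) hp.2.le (by linarith)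
      have e2 : (p : ℝ) ^ (-(1 - (η + θ))) ≤ ((p - 1 : ℕ) : ℝ) ^ (-(1 - (η + θ))) :=
        Real.rpow_le_rpow_of_nonpos hp1' (by exact_mod_cast Nat.sub_le p 1) (by linarith)
      have e3 : (roughPart y (p - 1) : ℕ) =
          primeMulHom (fun r : ℕ => if y < r then r else 1) (p - 1) := by
        rw [roughPart_apply y hp1, primeMulHom_apply _ hp1]
      rw [hg]
      simp only
      rw [e, e3, mul_assoc]
      gcongr
    refine (Finset.sum_le_sum hterm).trans ?_
    rw [← Finset.mul_sum]
    apply mul_le_mul_of_nonneg_left _ (by positivity)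
    -- Since p ↦ p - 1 is injective and the terms are nonnegative, the sum may be extended to all 1
    -- ≤ m ≤ N.
    rw [← Finset.sum_image (f := fun m => primeMulHom h m) (g := fun p => p - 1)]
    · apply Finset.sum_le_sum_of_subset_of_nonneg
      · intro m hm
        obtain ⟨p, hp, rfl⟩ := Finset.mem_image.1 hm
        rw [Finset.mem_filter] at hp
        have h1 := (Nat.prime_of_mem_primesBelow hp.1).two_le
        have h2 := Nat.lt_of_mem_primesBelow hp.1
        simp only [Finset.mem_Icc]; omega
      · exact fun n _ _ => primeMulHom_nonneg hh0 n
    · intro p hp q hq hpq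
      have h1 := (Nat.prime_of_mem_primesBelow (Finset.mem_filter.1 hp).1).two_le
      have h2 := (Nat.prime_of_mem_primesBelow (Finset.mem_filter.1 hq).1).two_le
      simp only at hpq
      omega

/-! ### Removing the exceptional sets. -/

theorem card_le_add_of_split {S : Finset ℕ} (P : ℕ → Prop) {a b : ℝ}
    (h1 : ∀ U ⊆ S, (∀ n ∈ U, P n) → (U.card : ℝ) ≤ a)
    (h2 : ∀ U ⊆ S, (∀ n ∈ U, ¬ P n) → (U.card : ℝ) ≤ b) : (S.card : ℝ) ≤ a + b := by
  classical
  rw [← Finset.card_filter_add_card_filter_not (s := S) P]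
  push_cast
  exact add_le_add (h1 _ (Finset.filter_subset _ _) fun n hn => (Finset.mem_filter.1 hn).2)
    (h2 _ (Finset.filter_subset _ _) fun n hn => (Finset.mem_filter.1 hn).2)

theorem not_prime_dvd_of_abs_lt {k : ℤ} (hk : k ≠ 0) {B : ℝ} (hkB : |(k : ℝ)| < B) {p : ℕ}
    (hp : B < p) : ¬ (p : ℤ) ∣ k := by
  intro h
  have h1 : (p : ℤ) ≤ |k| := Int.le_of_dvd (abs_pos.2 hk) ((dvd_abs _ _).2 h)
  have h2 : ((p : ℤ) : ℝ) ≤ ((|k| : ℤ) : ℝ) := by exact_mod_cast h1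
  rw [Int.cast_abs, Int.cast_natCast] at h2
  linarith

/-- The nesting is that of seven successive splittings. Each exceptional term is a constant times
(x/B)(1 + 2 log x)³; the constants add up to 25. -/
theorem exceptional_bound_le {x B : ℝ} (hB : 2 ≤ B) (hBlx : B ≤ x) (G : ℝ) :
    2 * x / B + (2 * (2 * x) / B +
      (2 * (x + x) * (1 + Real.log x) ^ 2 / B +
      ((2 * x * (1 + Real.log x) ^ 2 / B + x / B * (1 + Real.log x) ^ 3) +
      ((2 * (2 * x) * (1 + Real.log (2 * x)) ^ 2 / B +
        2 * x / B * (1 + Real.log (2 * x)) ^ 3) +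
      (2 * x / B * (1 + Real.log (2 * x / B)) ^ 2 +
      (2 * (x + x * B) * (1 + Real.log (x * B)) ^ 2 / B ^ 2 + G)))))) ≤
    30 * x * (1 + 2 * Real.log x) ^ 3 / B + G := by
  have hB0 : 0 < B := by linarith
  have hx2 : 2 ≤ x := hB.trans hBlx
  have hlx : 0 ≤ Real.log x := Real.log_nonneg (by linarith)
  set ℓ := 1 + 2 * Real.log x with hℓ
  have hℓ1 : 1 ≤ ℓ := by linarith
  have hlogx : 1 + Real.log x ≤ ℓ := by linarith
  have hlog2x : 1 + Real.log (2 * x) ≤ ℓ := by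
    have := Real.log_le_log (by norm_num) hx2
    rw [Real.log_mul (by positivity) (by positivity)]
    linarith
  have hlogxB : 1 + Real.log (x * B) ≤ ℓ := by
    have := Real.log_le_log hB0 hBlx
    rw [Real.log_mul (by positivity) (by positivity)]
    linarith
  have hxB0 : 0 ≤ x / B := by positivity
  have l0 : 0 ≤ Real.log (2 * x) := Real.log_nonneg (by linarith)
  have l1 : 0 ≤ Real.log (x * B) := Real.log_nonneg (by nlinarith)
  have l2 : 0 ≤ Real.log (2 * x / B) := Real.log_nonneg (by rw [one_le_div hB0]; linarith)
  have l3 : 1 + Real.log (2 * x / B) ≤ ℓ := by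
    have := Real.log_le_log (by positivity) (div_le_self (by positivity) (by linarith) :
      2 * x / B ≤ 2 * x)
    linarith
  have p0 : (1 : ℝ) ≤ ℓ ^ 3 := one_le_pow₀ hℓ1
  have p2 : ∀ t : ℝ, 0 ≤ t → 1 + t ≤ ℓ → (1 + t) ^ 2 ≤ ℓ ^ 3 := fun t ht h =>
    (pow_le_pow_left₀ (by linarith) h 2).trans (pow_le_pow_right₀ hℓ1 (by norm_num))
  have p3 : ∀ t : ℝ, 0 ≤ t → 1 + t ≤ ℓ → (1 + t) ^ 3 ≤ ℓ ^ 3 := fun t ht h =>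
    pow_le_pow_left₀ (by linarith) h 3
  have q1 := mul_le_mul_of_nonneg_left p0 hxB0
  have q2 := mul_le_mul_of_nonneg_left (p2 _ hlx hlogx) hxB0
  have q3 := mul_le_mul_of_nonneg_left (p3 _ hlx hlogx) hxB0
  have q4 := mul_le_mul_of_nonneg_left (p2 _ l0 hlog2x) hxB0
  have q5 := mul_le_mul_of_nonneg_left (p3 _ l0 hlog2x) hxB0
  have q6 := mul_le_mul_of_nonneg_left (p2 _ l1 hlogxB) hxB0
  have q7 := mul_le_mul_of_nonneg_left (p2 _ l2 l3) hxB0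
  have e : 2 * (x + x * B) * (1 + Real.log (x * B)) ^ 2 / B ^ 2 ≤
      4 * (x / B * (1 + Real.log (x * B)) ^ 2) := by
    rw [div_le_iff₀ (by positivity)]
    have : x + x * B ≤ 2 * (x * B) := by nlinarith
    calc _ ≤ 2 * (2 * (x * B)) * (1 + Real.log (x * B)) ^ 2 := by gcongr
      _ = _ := by field_simp; ring
  have r : 30 * x * ℓ ^ 3 / B = 30 * (x / B * ℓ ^ 3) := by ring
  rw [r]
  have : 0 ≤ x / B * ℓ ^ 3 := by positivity
  calc _ = 2 * (x / B * 1) + (4 * (x / B * 1) + (4 * (x / B * (1 + Real.log x) ^ 2) +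
      ((2 * (x / B * (1 + Real.log x) ^ 2) + x / B * (1 + Real.log x) ^ 3) +
      ((4 * (x / B * (1 + Real.log (2 * x)) ^ 2) + 2 * (x / B * (1 + Real.log (2 * x)) ^ 3)) +
      (2 * (x / B * (1 + Real.log (2 * x / B)) ^ 2) +
      (2 * (x + x * B) * (1 + Real.log (x * B)) ^ 2 / B ^ 2 + G)))))) := by ring
    _ ≤ _ := by linarith

set_option maxHeartbeats 1000000 in
/-- The solutions of `φ(n) = φ(n + k)` up to `x`, reduced to those for which the rough part of
`∏ (p - 1)` is small, which are counted by Rankin's method. -/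
theorem totientShiftCount_le {k : ℤ} (hk : Odd k) {x B s α : ℝ} (hkB : |(k : ℝ)| < B)
    (hB : 2 ≤ B) (hBx : 4 * B ^ 3 < x) (hs : 1 / 2 ≤ s) (hα : 0 ≤ α) :
    (totientShiftCount k x : ℝ) ≤ 30 * x * (1 + 2 * Real.log x) ^ 3 / B +
      x ^ s * (B ^ 8) ^ α * Real.exp (4 * ∑ p ∈ (⌊x⌋₊ + 1).primesBelow,
      (p : ℝ) ^ (-s) * ((roughPart B (p - 1) : ℕ) : ℝ) ^ (-α)) := by
  have hk0 : k ≠ 0 := by rintro rfl; simp at hk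
  have hB0 : 0 < B := by linarith
  have hBlx : B ≤ x := by nlinarith [sq_nonneg B, mul_pos hB0 hB0, mul_pos (mul_pos hB0 hB0) hB0]
  have hx2 : 2 ≤ x := hB.trans hBlx
  set S₀ := (Finset.Icc 1 ⌊x⌋₊).filter fun n : ℕ =>
    0 < (n : ℤ) + k ∧ Nat.totient n = Nat.totient ((n : ℤ) + k).toNat with hS₀
  have hcount : (totientShiftCount k x : ℝ) = S₀.card := rfl
  set N : ℕ → ℕ := fun n => ((n : ℤ) + k).toNat with hN
  have hS : ∀ n ∈ S₀, 1 ≤ n ∧ (n : ℝ) ≤ x ∧ ((N n : ℕ) : ℤ) = n + k ∧ 1 ≤ N n ∧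
      (N n : ℝ) ≤ 2 * x ∧ n.totient = (N n).totient := by
    intro n hn
    simp only [hS₀, Finset.mem_filter, Finset.mem_Icc] at hn
    obtain ⟨⟨h1, h2⟩, h3, h4⟩ := hn
    have hnx : (n : ℝ) ≤ x := (Nat.le_floor_iff (by linarith)).1 h2
    have hNe : ((N n : ℕ) : ℤ) = n + k := Int.toNat_of_nonneg h3.le
    have hNr : (N n : ℝ) = n + k := by exact_mod_cast hNe
    refine ⟨h1, hnx, hNe, by omega, ?_, h4⟩
    have := le_abs_self (k : ℝ)
    linarith
  -- The shift is injective, so conditions on n + k can be counted on the shifted set.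
  have himg : ∀ U ⊆ S₀, (U.image N).card = U.card := by
    intro U hU
    apply Finset.card_image_of_injOn
    intro a ha b hb hab
    have h1 := (hS a (hU ha)).2.2.1
    have h2 := (hS b (hU hb)).2.2.1
    rw [hab] at h1
    omega
  have hgt : ∀ p q : ℕ, p.Prime → q.Prime → B < (Nat.gcd (p - 1) (q - 1) : ℕ) →
      B < p ∧ B < q := by
    intro p q hp hq h
    have hp2 := hp.two_le
    have hq2 := hq.two_le
    have h1 := Nat.le_of_dvd (by omega) (Nat.gcd_dvd_left (p - 1) (q - 1))
    have h2 := Nat.le_of_dvd (by omega) (Nat.gcd_dvd_right (p - 1) (q - 1))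
    have h1' : Nat.gcd (p - 1) (q - 1) ≤ p := by omega
    have h2' : Nat.gcd (p - 1) (q - 1) ≤ q := by omega
    exact ⟨h.trans_le (by exact_mod_cast h1'), h.trans_le (by exact_mod_cast h2')⟩
  have hdvdN : ∀ n ∈ S₀, ∀ q : ℕ, q ∣ N n → (q : ℤ) ∣ n + k := by
    intro n hn q hq
    rw [← (hS n hn).2.2.1]
    exact_mod_cast hq
  have hne : ∀ n ∈ S₀, ∀ p q : ℕ, B < p → p ∣ n → q ∣ N n → p ≠ q := by
    rintro n hn p q hBp hpn hqN rfl
    have h1 : (p : ℤ) ∣ n := by exact_mod_cast hpn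
    exact not_prime_dvd_of_abs_lt hk0 hkB hBp ((dvd_add_right h1).1 (hdvdN n hn p hqN))
  set G := x ^ s * (B ^ 8) ^ α * Real.exp (4 * ∑ p ∈ (⌊x⌋₊ + 1).primesBelow,
      (p : ℝ) ^ (-s) * ((roughPart B (p - 1) : ℕ) : ℝ) ^ (-α)) with hG
  have hmain : (S₀.card : ℝ) ≤ 2 * x / B + (2 * (2 * x) / B +
      (2 * (x + x) * (1 + Real.log x) ^ 2 / B +
      ((2 * x * (1 + Real.log x) ^ 2 / B + x / B * (1 + Real.log x) ^ 3) +
      ((2 * (2 * x) * (1 + Real.log (2 * x)) ^ 2 / B +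
        2 * x / B * (1 + Real.log (2 * x)) ^ 3) +
      (2 * x / B * (1 + Real.log (2 * x / B)) ^ 2 +
      (2 * (x + x * B) * (1 + Real.log (x * B)) ^ 2 / B ^ 2 + G)))))) := by
    apply card_le_add_of_split (fun n => ∃ r : ℕ, B < r ∧ r ^ 2 ∣ n)
    · intro U hU hP
      exact card_le_of_sq_dvd hB0 (by linarith) fun n hn =>
        ⟨(hS n (hU hn)).1, (hS n (hU hn)).2.1, hP n hn⟩
    intro S₁ hS₁ hP₁
    apply card_le_add_of_split (fun n => ∃ r : ℕ, B < r ∧ r ^ 2 ∣ N n)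
    · intro U hU hP
      rw [← himg U (hU.trans hS₁)]
      refine card_le_of_sq_dvd hB0 (by linarith) fun m hm => ?_
      obtain ⟨n, hn, rfl⟩ := Finset.mem_image.1 hm
      have h := hS n (hS₁ (hU hn))
      exact ⟨h.2.2.2.1, h.2.2.2.2.1, hP n hn⟩
    intro S₂ hS₂ hP₂
    replace hP₁ : ∀ n ∈ S₂, _ := fun n hn => hP₁ n (hS₂ hn)
    replace hS₂ := hS₂.trans hS₁
    apply card_le_add_of_split (fun n => ∃ p q : ℕ, p.Prime ∧ q.Prime ∧ p ∣ n ∧ q ∣ N n ∧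
      B < (Nat.gcd (p - 1) (q - 1) : ℕ) ∧ (p : ℝ) * q ≤ x)
    · intro U hU hP
      refine card_le_of_common_divisor (k := k) hB0 (by linarith) (by linarith) fun n hn => ?_
      have hn' := hS₂ (hU hn)
      obtain ⟨p, q, hp, hq, hpn, hqN, hgcd, hpq⟩ := hP n hn
      exact ⟨(hS n hn').2.1, p, q, _, hp, hq, hne n hn' p q (hgt p q hp hq hgcd).1 hpn hqN, hpn,
        hdvdN n hn' q hqN, hgcd, Nat.gcd_dvd_left _ _, Nat.gcd_dvd_right _ _, hpq⟩
    intro S₃ hS₃ hP₃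
    replace hP₁ : ∀ n ∈ S₃, _ := fun n hn => hP₁ n (hS₃ hn)
    replace hP₂ : ∀ n ∈ S₃, _ := fun n hn => hP₂ n (hS₃ hn)
    replace hS₃ := hS₃.trans hS₂
    apply card_le_add_of_split (fun n => ∃ p q : ℕ, p.Prime ∧ q.Prime ∧ p ∣ n ∧ q ∣ N n ∧
      B < (Nat.gcd (p - 1) (q - 1) : ℕ) ∧ (q : ℝ) * B ≤ p)
    · intro U hU hP
      refine card_le_of_common_divisor_of_mul_le (k := k) hB0 (by linarith) (by linarith)
        fun n hn => ?_
      have hn' := hS₃ (hU hn)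
      obtain ⟨p, q, hp, hq, hpn, hqN, hgcd, hpq⟩ := hP n hn
      exact ⟨(hS n hn').1, (hS n hn').2.1, p, q, _, hp, hq, hpn, hdvdN n hn' q hqN,
        not_prime_dvd_of_abs_lt hk0 hkB (hgt p q hp hq hgcd).2, hgcd,
        Nat.gcd_dvd_left _ _, Nat.gcd_dvd_right _ _, hpq⟩
    intro S₄ hS₄ hP₄
    replace hP₁ : ∀ n ∈ S₄, _ := fun n hn => hP₁ n (hS₄ hn)
    replace hP₂ : ∀ n ∈ S₄, _ := fun n hn => hP₂ n (hS₄ hn)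
    replace hP₃ : ∀ n ∈ S₄, _ := fun n hn => hP₃ n (hS₄ hn)
    replace hS₄ := hS₄.trans hS₃
    apply card_le_add_of_split (fun n => ∃ p q : ℕ, p.Prime ∧ q.Prime ∧ p ∣ n ∧ q ∣ N n ∧
      B < (Nat.gcd (p - 1) (q - 1) : ℕ) ∧ (p : ℝ) * B ≤ q)
    -- The previous case with n and n + k exchanged, so that the shift becomes -k.
    · intro U hU hP
      rw [← himg U (hU.trans hS₄)]
      refine card_le_of_common_divisor_of_mul_le (k := -k) hB0 (by linarith) (by linarith)
        fun m hm => ?_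
      obtain ⟨n, hn, rfl⟩ := Finset.mem_image.1 hm
      have hn' := hS₄ (hU hn)
      have h := hS n hn'
      obtain ⟨p, q, hp, hq, hpn, hqN, hgcd, hpq⟩ := hP n hn
      refine ⟨h.2.2.2.1, h.2.2.2.2.1, q, p, _, hq, hp, hqN, ?_, ?_, hgcd,
        Nat.gcd_dvd_right _ _, Nat.gcd_dvd_left _ _, hpq⟩
      · rw [h.2.2.1, add_neg_cancel_right]
        exact_mod_cast hpn
      · rw [dvd_neg]
        exact not_prime_dvd_of_abs_lt hk0 hkB (hgt p q hp hq hgcd).1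
    intro S₅ hS₅ hP₅
    replace hP₁ : ∀ n ∈ S₅, _ := fun n hn => hP₁ n (hS₅ hn)
    replace hP₂ : ∀ n ∈ S₅, _ := fun n hn => hP₂ n (hS₅ hn)
    replace hP₃ : ∀ n ∈ S₅, _ := fun n hn => hP₃ n (hS₅ hn)
    replace hP₄ : ∀ n ∈ S₅, _ := fun n hn => hP₄ n (hS₅ hn)
    replace hS₅ := hS₅.trans hS₄
    apply card_le_add_of_split (fun n => ∃ p q : ℕ, p.Prime ∧ q.Prime ∧ p ∣ n ∧ q ∣ N n ∧
      B < (Nat.gcd (p - 1) (q - 1) : ℕ) ∧ x * B < (p : ℝ) * q)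
    · intro U hU hP
      refine card_le_of_large_prime_factors hk (by rw [one_le_div hB0]; linarith) fun n hn => ?_
      have hn' := hS₅ (hU hn)
      have h := hS n hn'
      obtain ⟨p, q, hp, hq, hpn, hqN, hgcd, hpq⟩ := hP n hn
      obtain ⟨hBp, hBq⟩ := hgt p q hp hq hgcd
      obtain ⟨m, hm⟩ := hpn
      obtain ⟨m', hm'⟩ := hqN
      refine ⟨h.1, h.2.2.2.2.2, p, q, m, m', hp, hq, ?_, ?_, ?_, ?_, hm, ?_, ?_⟩
      · rintro rfl; norm_num at hBp; linarith
      · rintro rfl; norm_num at hBq; linarith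
      · intro hpm
        refine hP₁ n (hU hn) ⟨p, hBp, ?_⟩
        rw [hm, sq]; exact mul_dvd_mul_left p hpm
      · intro hqm
        refine hP₂ n (hU hn) ⟨q, hBq, ?_⟩
        rw [hm', sq]; exact mul_dvd_mul_left q hqm
      · rw [← h.2.2.1, hm']
      · have e1 : (n : ℝ) = p * m := by exact_mod_cast hm
        have e2 : (N n : ℝ) = q * m' := by exact_mod_cast hm'
        have e3 : (n : ℝ) * N n ≤ x * (2 * x) := by
          have := h.2.1
          have := h.2.2.2.2.1
          gcongr
        rw [le_div_iff₀ hB0]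
        have hmm : (0 : ℝ) ≤ m * m' := by positivity
        have e4 : x * (m * m' * B) ≤ x * (2 * x) := by
          calc x * (m * m' * B) = x * B * (m * m') := by ring
            _ ≤ p * q * (m * m') := by gcongr
            _ = (p * m) * (q * m') := by ring
            _ = n * N n := by rw [e1, e2]
            _ ≤ _ := e3
        exact le_of_mul_le_mul_left e4 (by linarith)
    intro S₆ hS₆ hP₆
    replace hP₁ : ∀ n ∈ S₆, _ := fun n hn => hP₁ n (hS₆ hn)
    replace hP₂ : ∀ n ∈ S₆, _ := fun n hn => hP₂ n (hS₆ hn)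
    replace hP₃ : ∀ n ∈ S₆, _ := fun n hn => hP₃ n (hS₆ hn)
    replace hP₄ : ∀ n ∈ S₆, _ := fun n hn => hP₄ n (hS₆ hn)
    replace hP₅ : ∀ n ∈ S₆, _ := fun n hn => hP₅ n (hS₆ hn)
    replace hS₆ := hS₆.trans hS₅
    have hB1 : B ≤ B ^ 2 := by nlinarith
    apply card_le_add_of_split (fun n => ∃ p q : ℕ, p.Prime ∧ q.Prime ∧ p ∣ n ∧ q ∣ N n ∧
      B ^ 2 < (Nat.gcd (p - 1) (q - 1) : ℕ) ∧ (p : ℝ) * q ≤ x * B)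
    · intro U hU hP
      refine card_le_of_common_divisor (k := k) (by positivity) (by linarith) (by nlinarith)
        fun n hn => ?_
      have hn' := hS₆ (hU hn)
      obtain ⟨p, q, hp, hq, hpn, hqN, hgcd, hpq⟩ := hP n hn
      exact ⟨(hS n hn').2.1, p, q, _, hp, hq,
        hne n hn' p q (hgt p q hp hq (hB1.trans_lt hgcd)).1 hpn hqN, hpn,
        hdvdN n hn' q hqN, hgcd, Nat.gcd_dvd_left _ _, Nat.gcd_dvd_right _ _, hpq⟩
    intro S₇ hS₇ hP₇
    apply card_le_rankin (by linarith) hs hα (by positivity)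
    intro n hn
    have hn' := hS₇ hn
    have h := hS n (hS₆ hn')
    refine ⟨h.1, h.2.1, ?_⟩
    have hxB : 1 ≤ x / B := by rwa [one_le_div hB0]
    -- With c = √(x/B), the square of this inequality is exactly 4B³ < x. It limits both n and n + k
    -- to two primes above c.
    have hc3 : 2 * x < √(x / B) ^ 3 := by
      have hsq : √(x / B) ^ 2 = x / B := Real.sq_sqrt (by linarith)
      apply lt_of_pow_lt_pow_left₀ 2 (by positivity)
      rw [← pow_mul, mul_comm 3 2, pow_mul, hsq, div_pow, lt_div_iff₀ (by positivity)]
      have : 0 < x ^ 2 := by positivity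
      nlinarith
    have hfin := primeMulHom_roughPart_le (n := n) (N := N n) (B := B) (D := B ^ 2)
      (c := √(x / B)) (by have := h.1; omega) (by have := h.2.2.2.1; omega) h.2.2.2.2.2
      (by nlinarith) (Real.one_le_sqrt.2 hxB) (by linarith [h.2.1]) (by linarith [h.2.2.2.2.1])
      (fun q _ hBq hqN => hP₂ n hn' ⟨q, hBq, hqN⟩) (by
        intro p q hp hq hpn hqN hgcd
        obtain ⟨hBp, hBq⟩ := hgt p q hp hq hgcd
        have c3 : x < (p : ℝ) * q := by
          by_contra hc
          exact hP₃ n hn' ⟨p, q, hp, hq, hpn, hqN, hgcd, not_lt.1 hc⟩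
        have c4 : (p : ℝ) < q * B := by
          by_contra hc
          exact hP₄ n hn' ⟨p, q, hp, hq, hpn, hqN, hgcd, not_lt.1 hc⟩
        have c5 : (q : ℝ) < p * B := by
          by_contra hc
          exact hP₅ n hn' ⟨p, q, hp, hq, hpn, hqN, hgcd, not_lt.1 hc⟩
        have c6 : (p : ℝ) * q ≤ x * B := by
          by_contra hc
          exact hP₆ n hn' ⟨p, q, hp, hq, hpn, hqN, hgcd, not_le.1 hc⟩
        have hp0 : (0 : ℝ) < p := by linarith
        have hq0 : (0 : ℝ) < q := by linarith
        refine ⟨?_, ?_, ?_⟩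
        -- Near balance and pq > x give Bp² > pq > x, and symmetrically for q.
        · rw [Real.sqrt_lt' hp0, div_lt_iff₀ hB0]
          nlinarith [mul_lt_mul_of_pos_left c5 hp0]
        · rw [Real.sqrt_lt' hq0, div_lt_iff₀ hB0]
          nlinarith [mul_lt_mul_of_pos_left c4 hq0]
        · by_contra hc
          exact hP₇ n hn ⟨p, q, hp, hq, hpn, hqN, not_le.1 hc, c6⟩)
    calc _ ≤ (B ^ 2) ^ 4 := hfin
      _ = B ^ 8 := by ring
  rw [hcount]
  exact hmain.trans (exceptional_bound_le hB hBlx G)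

/-! ### Choice of parameters. -/

set_option maxHeartbeats 1000000 in
/-- The bound for `totientShiftCount` in terms of `u = log (log x)`, for `u` large. -/
theorem totientShiftCount_le_of_large {k : ℤ} (hk : Odd k) {x u A : ℝ} (hx : 0 < x)
    (hL : Real.log x = Real.exp u) (hA0 : 0 ≤ A) (hA : A ^ 2 = Real.exp u * Real.log u / 2)
    (hu : 1 ≤ u) (h1 : u ≤ Real.exp (u / 4) / 10000) (h2 : 2 ≤ Real.log u)
    (h3 : 8 * u ^ (9 / 10 : ℝ) - u / 8 ≤ -Real.log 1000)
    (h4 : |(k : ℝ)| < Real.exp (u / 2) / 2) :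
    (totientShiftCount k x : ℝ) ≤ 31 * (x * Real.exp (-A)) := by
  set E := Real.exp (u / 4) with hE
  have hE0 : 0 < E := Real.exp_pos _
  have hE1 : 10000 ≤ E := by linarith
  have hE2 : Real.exp (u / 2) = E ^ 2 := by
    rw [hE, ← Real.exp_nat_mul]; congr 1; push_cast; ring
  have hE4 : Real.exp u = E ^ 4 := by
    rw [hE, ← Real.exp_nat_mul]; congr 1; push_cast; ring
  rw [hE2] at h4
  rw [hE4] at hA hL
  have hlu : Real.log u ≤ u := (Real.log_le_sub_one_of_pos (by linarith)).trans (by linarith)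
  have hAlow : E ^ 2 ≤ A := by
    refine le_of_pow_le_pow_left₀ two_ne_zero hA0 ?_
    rw [hA]; nlinarith [pow_pos hE0 4]
  have hAup : A ≤ E ^ 4 / 100 := by
    refine le_of_pow_le_pow_left₀ two_ne_zero (by positivity) ?_
    rw [hA]
    have e1 : Real.log u ≤ E / 10000 := hlu.trans h1
    have e2 : E ≤ E ^ 4 := le_self_pow₀ (by linarith) (by norm_num)
    have e3 : Real.log u / 2 ≤ E ^ 4 / 10000 := by linarith
    calc E ^ 4 * Real.log u / 2 = E ^ 4 * (Real.log u / 2) := by ring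
      _ ≤ E ^ 4 * (E ^ 4 / 10000) := by gcongr
      _ = _ := by ring
  have hEE : 10000 * E ≤ E ^ 2 := by nlinarith
  have hApos : 100000000 ≤ A := by linarith
  -- the parameter `B`
  set ℓ := Real.log (1 + 2 * Real.log x) with hℓ
  have hL1 : 1 ≤ 1 + 2 * Real.log x := by rw [hL]; linarith [pow_pos hE0 4]
  have hℓ0 : 0 ≤ ℓ := Real.log_nonneg hL1
  have hℓu : ℓ ≤ u + 2 := by
    rw [hℓ, Real.log_le_iff_le_exp (by linarith), Real.exp_add, hE4, hL]
    have e1 : (3 : ℝ) ≤ Real.exp 2 := by linarith [Real.add_one_le_exp (2 : ℝ)]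
    have e2 : 1 ≤ E ^ 4 := one_le_pow₀ (by linarith)
    have e3 := mul_le_mul_of_nonneg_left e1 (by linarith : 0 ≤ E ^ 4)
    linarith
  -- The summand 3ℓ makes B = exp(A) (1 + 2 log x)³, cancelling the logarithms in the exceptional
  -- bound.
  set b := A + 3 * ℓ with hb
  have hbA : A ≤ b := by linarith
  have hbup : b ≤ 11 / 10 * A := by linarith
  have hb0 : 0 < b := by linarith
  set B := Real.exp b with hB
  have hlogB : Real.log B = b := Real.log_exp b
  have hBb : b + 1 ≤ B := Real.add_one_le_exp b
  have hBeq : B = Real.exp A * (1 + 2 * Real.log x) ^ 3 := by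
    rw [hB, hb, Real.exp_add, hℓ, show (3 : ℝ) * Real.log (1 + 2 * Real.log x) =
      ((3 : ℕ) : ℝ) * Real.log (1 + 2 * Real.log x) by norm_num, Real.exp_nat_mul,
      Real.exp_log (by linarith)]
  have hBx : 4 * B ^ 3 < x := by
    rw [← Real.exp_log hx, hL, hB, ← Real.exp_nat_mul]
    have : (4 : ℝ) ≤ Real.exp 3 := by linarith [Real.add_one_le_exp (3 : ℝ)]
    calc 4 * Real.exp (((3 : ℕ) : ℝ) * b) ≤ Real.exp 3 * Real.exp (((3 : ℕ) : ℝ) * b) := by gcongr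
      _ = Real.exp (3 + 3 * b) := by rw [← Real.exp_add]; norm_num
      _ < _ := by
        apply Real.exp_lt_exp.2
        linarith
  -- the exponents
  set w := 3 / 5 * Real.log u with hw
  have hw1 : 6 / 5 ≤ w := by linarith
  have hwu : w ≤ u := by linarith
  set η := w / b with hη
  have hη0 : 0 < η := by positivity
  have hηb : η * b = w := by rw [hη]; field_simp
  have hwb : 3 * w ≤ b := by linarith
  have hη13 : η ≤ 1 / 3 := by rw [hη, div_le_iff₀ hb0]; linarith
  -- Chosen so that z^η = exp(u/4) = (log x)^(1/4), small against A, while z^(-η/2) = exp(-u/8)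
  -- still beats exp(8 u^(9/10)).
  set z := Real.exp (b * u / (4 * w)) with hz
  have hlogz : Real.log z = b * u / (4 * w) := Real.log_exp _
  have hlz0 : 0 < b * u / (4 * w) := by positivity
  have hz1 : 1 < z := by rw [hz, Real.one_lt_exp_iff]; exact hlz0
  have hsum := sum_prime_rpow_roughPart_le (y := B) (z := z) (η := η) (θ := η / 2) (α := 4 * η)
    (by linarith) hz1 hη0.le (by linarith) (by linarith) (by
      rw [hlogB]
      have : 1 / b ≤ η := by rw [hη]; gcongr; linarith
      linarith) ⌊x⌋₊
  have hcount := totientShiftCount_le hk (x := x) (B := B) (s := 1 - η) (α := 4 * η)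
    (by linarith) (by linarith) hBx (by linarith) (by linarith)
  set T := ∑ p ∈ (⌊x⌋₊ + 1).primesBelow,
    (p : ℝ) ^ (-(1 - η)) * ((roughPart B (p - 1) : ℕ) : ℝ) ^ (-(4 * η)) with hT
  rw [hlogB, hlogz] at hsum
  -- the small primes
  have hzη : z ^ η = E := by
    rw [hz, ← Real.exp_mul, hE]; congr 1
    rw [hη]; field_simp
  have hzθ : z ^ (-(η / 2)) = Real.exp (-(u / 8)) := by
    rw [hz, ← Real.exp_mul]; congr 1
    rw [hη]; field_simp; norm_num
  have hlogz2 : Real.log (1 + b * u / (4 * w)) ≤ 2 * u := by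
    rw [Real.log_le_iff_le_exp (by linarith)]
    have e0 : Real.exp (2 * u) = E ^ 4 * E ^ 4 := by rw [← hE4, ← Real.exp_add]; ring_nf
    have e1 : b * u / (4 * w) ≤ b * u := div_le_self (by positivity) (by linarith)
    have e2 : u ≤ E ^ 4 := by
      have : E ≤ E ^ 4 := le_self_pow₀ (by linarith) (by norm_num)
      linarith
    have e3 : b ≤ E ^ 4 / 2 := by linarith [pow_pos hE0 4]
    have e4 : b * u ≤ E ^ 4 / 2 * E ^ 4 := by gcongr
    have e5 : 2 ≤ E ^ 4 := by linarith
    have e6 : 2 * 1 ≤ E ^ 4 * E ^ 4 := mul_le_mul e5 (by linarith) (by norm_num) (by linarith)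
    rw [e0]; linarith
  have hS1 : z ^ η * (Real.exp 1 * Real.log (1 + b * u / (4 * w))) ≤ A / 1000 := by
    rw [hzη]
    have e1 : Real.exp 1 ≤ 3 := by linarith [Real.exp_one_lt_d9]
    have e2 : 0 ≤ Real.log (1 + b * u / (4 * w)) := Real.log_nonneg (by linarith)
    calc E * (Real.exp 1 * Real.log (1 + b * u / (4 * w))) ≤ E * (3 * (2 * (E / 10000))) := by
          gcongr
          linarith
      _ = E ^ 2 * (6 / 10000) := by ring
      _ ≤ _ := by linarith
  -- the large primes
  have hexp : Real.exp ((η + η / 2) * b) = u ^ (9 / 10 : ℝ) := by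
    rw [Real.rpow_def_of_pos (by linarith)]
    congr 1
    calc (η + η / 2) * b = 3 / 2 * (η * b) := by ring
      _ = _ := by rw [hηb, hw]; ring
  have hS2 : z ^ (-(η / 2)) * ((1 + b) * Real.exp (4 * Real.exp ((η + η / 2) * b) *
      ((b + Real.log 4) / b))) ≤ A * (2 / 1000) := by
    rw [hzθ, hexp]
    have e1 : (b + Real.log 4) / b ≤ 2 := by
      rw [div_le_iff₀ hb0]
      have : Real.log 4 ≤ 4 - 1 := Real.log_le_sub_one_of_pos (by norm_num)
      linarith
    have hu9 : 0 ≤ u ^ (9 / 10 : ℝ) := by positivity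
    have e2 : 4 * u ^ (9 / 10 : ℝ) * ((b + Real.log 4) / b) ≤ 8 * u ^ (9 / 10 : ℝ) := by
      linarith [mul_le_mul_of_nonneg_left e1 hu9]
    calc _ ≤ Real.exp (-(u / 8)) * ((2 * A) * Real.exp (8 * u ^ (9 / 10 : ℝ))) := by
          gcongr; linarith
      _ = 2 * A * Real.exp (8 * u ^ (9 / 10 : ℝ) - u / 8) := by
          rw [sub_eq_add_neg, Real.exp_add]; ring
      _ ≤ 2 * A * Real.exp (-Real.log 1000) := by gcongr
      _ = _ := by rw [Real.exp_neg, Real.exp_log (by norm_num)]; ring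
  have hT : T ≤ A * (3 / 1000) := by linarith
  have hG : x ^ (1 - η) * (B ^ 8) ^ (4 * η) * Real.exp (4 * T) ≤ x * Real.exp (-A) := by
    have e1 : x ^ (1 - η) = x * Real.exp (-(E ^ 4 * η)) := by
      rw [Real.rpow_sub hx, Real.rpow_one, Real.rpow_def_of_pos hx, hL, Real.exp_neg]
      rfl
    have e2 : (B ^ 8) ^ (4 * η) = Real.exp (32 * w) := by
      rw [hB, ← Real.exp_nat_mul, ← Real.exp_mul]; congr 1
      rw [← hηb]; push_cast; ring
    rw [e1, e2, mul_assoc, mul_assoc, ← Real.exp_add, ← Real.exp_add]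
    apply mul_le_mul_of_nonneg_left _ hx.le
    apply Real.exp_le_exp.2
    -- Here log x · w = (6/5)A² and b ≤ (11/10)A. The surplus A/11 covers 32w and 4T.
    have e3 : 12 / 11 * A ≤ E ^ 4 * η := by
      rw [hη, ← mul_div_assoc, le_div_iff₀ hb0]
      have : E ^ 4 * w = 6 / 5 * A ^ 2 := by rw [hA, hw]; ring
      rw [this]
      linarith [mul_le_mul_of_nonneg_left hbup hA0]
    linarith
  have hmain : 30 * x * (1 + 2 * Real.log x) ^ 3 / B = 30 * (x * Real.exp (-A)) := by
    rw [hBeq, Real.exp_neg]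
    have : 1 + 2 * Real.log x ≠ 0 := by linarith
    field_simp
  rw [hmain] at hcount
  linarith

theorem totientShiftCount_le_self (k : ℤ) {x : ℝ} (hx : 0 ≤ x) :
    (totientShiftCount k x : ℝ) ≤ x := by
  have h : totientShiftCount k x ≤ ⌊x⌋₊ := by
    have := Finset.card_filter_le (Finset.Icc 1 ⌊x⌋₊) (fun n : ℕ =>
      0 < (n : ℤ) + k ∧ Nat.totient n = Nat.totient ((n : ℤ) + k).toNat)
    rwa [Nat.card_Icc, Nat.add_sub_cancel] at this
  exact le_trans (by exact_mod_cast h) (Nat.floor_le hx)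

open Filter in
theorem eventually_large_conditions (K : ℝ) : ∀ᶠ u : ℝ in atTop,
    1 ≤ u ∧ u ≤ Real.exp (u / 4) / 10000 ∧ 2 ≤ Real.log u ∧
      8 * u ^ (9 / 10 : ℝ) - u / 8 ≤ -Real.log 1000 ∧ K < Real.exp (u / 2) / 2 := by
  have hexp : Tendsto (fun u : ℝ => Real.exp (u / 2) / 2) atTop atTop :=
    (Real.tendsto_exp_atTop.comp (tendsto_id.atTop_div_const (by norm_num))).atTop_div_const
      (by norm_num)
  have h1 : ∀ᶠ u : ℝ in atTop, u ≤ Real.exp (u / 4) / 10000 := by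
    have := (isLittleO_pow_exp_pos_mul_atTop 1 (by norm_num : (0 : ℝ) < 1 / 4)).bound
      (by norm_num : (0 : ℝ) < 1 / 10000)
    filter_upwards [this] with u hu
    rw [pow_one, Real.norm_of_nonneg (Real.exp_pos _).le] at hu
    have := Real.le_norm_self u
    rw [show u / 4 = 1 / 4 * u by ring]
    linarith
  have h3 : ∀ᶠ u : ℝ in atTop, 8 * u ^ (9 / 10 : ℝ) - u / 8 ≤ -Real.log 1000 := by
    filter_upwards [(tendsto_rpow_atTop (by norm_num : (0 : ℝ) < 1 / 10)).eventually_ge_atTop 128,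
      eventually_ge_atTop (16 * Real.log 1000), eventually_gt_atTop 0] with u h1 h2 h0
    have e : u = u ^ (9 / 10 : ℝ) * u ^ (1 / 10 : ℝ) := by
      rw [← Real.rpow_add h0]; norm_num
    have : 128 * u ^ (9 / 10 : ℝ) ≤ u := by
      conv_rhs => rw [e]
      rw [mul_comm]; gcongr
    linarith
  filter_upwards [eventually_ge_atTop 1, h1, Real.tendsto_log_atTop.eventually_ge_atTop 2, h3,
    hexp.eventually_gt_atTop K] with u a b c d e using ⟨a, b, c, d, e⟩

theorem corollary1p3 (k : ℤ) (hk : Odd k) :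
    ∃ C : ℝ, 0 < C ∧ ∀ x : ℝ, Real.exp (Real.exp 1) ≤ x →
      (totientShiftCount k x : ℝ) ≤
        C * (x * Real.exp (-((2 : ℝ) ^ (-(1 / 2) : ℝ)) *
          (Real.log x * Real.log (Real.log (Real.log x))) ^ (1 / 2 : ℝ))) := by
  obtain ⟨u₀, hu₀⟩ := Filter.eventually_atTop.1 (eventually_large_conditions |(k : ℝ)|)
  set c : ℝ := (2 : ℝ) ^ (-(1 / 2) : ℝ) with hc
  have hc0 : 0 < c := by positivity
  have hc2 : c ^ 2 = 1 / 2 := by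
    rw [hc, ← Real.rpow_natCast, ← Real.rpow_mul (by norm_num)]
    norm_num [Real.rpow_neg_one]
  set A₀ := c * (Real.exp u₀ * Real.log u₀) ^ (1 / 2 : ℝ) with hA₀
  refine ⟨31 + Real.exp A₀, by positivity, fun x hx => ?_⟩
  have hx0 : 0 < x := (Real.exp_pos _).trans_le hx
  have hL : Real.exp 1 ≤ Real.log x := (Real.le_log_iff_exp_le hx0).2 hx
  have hL0 : 0 < Real.log x := (Real.exp_pos _).trans_le hL
  have hu : 1 ≤ Real.log (Real.log x) := (Real.le_log_iff_exp_le hL0).2 hL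
  set u := Real.log (Real.log x) with hudef
  have hLu : Real.log x = Real.exp u := (Real.exp_log hL0).symm
  have hlu : 0 ≤ Real.log u := Real.log_nonneg hu
  set A := c * (Real.log x * Real.log u) ^ (1 / 2 : ℝ) with hA
  have hA0 : 0 ≤ A := by positivity
  have hAe : -c * (Real.log x * Real.log u) ^ (1 / 2 : ℝ) = -A := by rw [hA]; ring
  rw [hAe]
  have hpos : 0 ≤ x * Real.exp (-A) := by positivity
  rcases le_or_gt u₀ u with h | h
  · obtain ⟨h1, h2, h3, h4, h5⟩ := hu₀ u h
    have hA2 : A ^ 2 = Real.exp u * Real.log u / 2 := by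
      rw [hA, mul_pow, hc2, ← hLu, ← Real.rpow_natCast, ← Real.rpow_mul (by positivity)]
      norm_num
      ring
    have := totientShiftCount_le_of_large hk hx0 hLu hA0 hA2 h1 h2 h3 h4 h5
    have : 0 ≤ Real.exp A₀ * (x * Real.exp (-A)) := by positivity
    linarith
  -- Below the threshold A is bounded by A₀, so the trivial count x is enough.
  · have hAA : A ≤ A₀ := by
      rw [hA, hA₀, hLu]
      have := Real.log_le_log (by linarith) h.le
      have := Real.exp_le_exp.2 h.le
      gcongr
    have h1 := totientShiftCount_le_self k hx0.le
    have h2 : x ≤ Real.exp A₀ * (x * Real.exp (-A)) := by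
      have : 1 ≤ Real.exp A₀ * Real.exp (-A) := by
        rw [← Real.exp_add]; exact Real.one_le_exp (by linarith)
      nlinarith
    linarith
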